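/- \textbf{Theorem (Representation stability with changing coefficients).} Let $G$ be a group of type $FP_\infty$, i.e. the trivial $\mathbb{Z}G$-module $\mathbb{Z}$ has a resolution by finitely generated projective $\mathbb{Z}G$-modules. \emph{Definitions.} For a partition $\lambda=(\lambda_1\ge\dots\ge\lambda_l)$ of $k$ and $n\ge k+\lambda_1$, let $V(\lambda)_n$ be the irreducible rational $S_n$-representation corresponding to the partition $(n-k,\lambda_1,\dots,\lambda_l)$ of $n$. A \emph{consistent sequence} $\{V_n,\phi_n\}_{n\ge 1}$ consists of rational $S_n$-representations $V_n$ and linear maps $\phi_n\colon V_n\to V_{n+1}$ that are equivariant with respect to the natural inclusion $S_n\hookrightarrow S_{n+1}$. It is \emph{compatible with $G$-actions} if each $V_n$ is also a $G$-module, the $G$-action commutes with the $S_n$-action, and each $\phi_n$ is a $G$-map. A consistent sequence is \begin{itemize} \item \emph{uniformly representation stable with stable range $n\ge N$} if every $V_n$ is finite-dimensional and, for all $n\ge N$: $\phi_n$ is injective; the $S_{n+1}$-span of $\phi_n(V_n)$ is $V_{n+1}$; and, for every partition $\lambda$, the multiplicity of $V(\lambda)_n$ in $V_n$ (taken to be $0$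 when $V(\lambda)_n$ is not defined) is independent of $n\ge N$; \item \emph{monotone for $n\ge N$} if for all $n\ge N$ the map $\phi_n$ is injective and, for every partition $\lambda$ for which $V(\lambda)_n$ is defined, every $k\ge 0$ and every subrepresentation $W\le V_n$ isomorphic to $V(\lambda)_n^{\oplus k}$, the $S_{n+1}$-span of $\phi_n(W)$ contains a subrepresentation isomorphic to $V(\lambda)_{n+1}^{\oplus k}$. \end{itemize} \emph{Statement.} Let $\{V_n,\phi_n\}_{n\ge1}$ be a consistent sequence of finite-dimensional rational $S_n$-representations compatible with $G$-actions, and let $N\ge 0$. If $\{V_n,\phi_n\}$ is monotone for $n\ge N$ and uniformly representation stable with stable range $n\ge N$, then for every integer $p\ge0$ the sequence $\{H^p(G;V_n),\phi_n^*\}_{n\ge1}$, with the $S_n$-actions and the maps $\phi_n^*$ induced from those on the coefficients, is a consistent sequence that is monotone for $n\ge N$ and uniformly representation stable with stable range $n\ge N$. -/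

import Mathlib

open scoped MonoidAlgebra CategoryTheory

noncomputable section

namespace RepStab

/-! ### Groups of type `FP_∞` -/

/-- `G` is of type `FP_∞`: the trivial `ℤ[G]`-module `ℤ` has a resolution
`⋯ → P 1 → P 0 → ℤ → 0` by finitely generated projective `ℤ[G]`-modules. -/
def TypeFPInfinity (G : Type) [Group G] : Prop :=
  ∃ (P : ℕ → Type) (_ : ∀ i, AddCommGroup (P i)) (_ : ∀ i, Module ℤ[G] (P i))
    (d : ∀ i, P (i + 1) →ₗ[ℤ[G]] P i)
    (ε : P 0 →ₗ[ℤ[G]] (Representation.trivial ℤ G ℤ).asModule),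
    (∀ i, Module.Finite ℤ[G] (P i)) ∧ (∀ i, Module.Projective ℤ[G] (P i)) ∧
    Function.Surjective ε ∧ Function.Exact (d 0) ε ∧
    ∀ i, Function.Exact (d (i + 1)) (d i)

/-! ### The irreducible representations `V_μ` of the symmetric groups -/

/-- The group algebra `ℚ[S_n]`. -/
abbrev QS (n : ℕ) : Type := ℚ[Equiv.Perm (Fin n)]

/-- The Young symmetrizer `c_T = a_T * b_T` of a tableau `T`, a bijective filling of the boxes of
`μ` by `Fin n`: `a_T` is the sum of the permutations preserving every row of `T`, and `b_T` is the
signed sum of the permutations preserving every column of `T`. A box is a pair (row, column). -/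
def youngSymmetrizer {n : ℕ} {μ : YoungDiagram} (T : Fin n ≃ μ.cells) : QS n :=
  (∑ g : Equiv.Perm (Fin n) with ∀ i, (T (g i)).1.1 = (T i).1.1, MonoidAlgebra.single g (1 : ℚ)) *
  (∑ g : Equiv.Perm (Fin n) with ∀ i, (T (g i)).1.2 = (T i).1.2,
    MonoidAlgebra.single g (((Equiv.Perm.sign g : ℤˣ) : ℤ) : ℚ))

/-- The irreducible representation `V_μ` of `S_n`, for a partition `μ` of `n` (given by its Young
diagram): the left ideal `ℚ[S_n] * c_T`. Up to isomorphism it does not depend on the tableau `T`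
of shape `μ`, so an arbitrary one is used. -/
def irrep {n : ℕ} (μ : YoungDiagram) (h : μ.card = n) : Ideal (QS n) :=
  Ideal.span {youngSymmetrizer (Finset.equivFinOfCardEq h).symm}

/-- For a partition `μ = (μ₁ ≥ μ₂ ≥ ⋯)` of `k` and `n ≥ k + μ₁`, the padded partition
`μ[n] = (n - k, μ₁, μ₂, …)` of `n`, as a Young diagram: a first row of length `n - k` is put
above the rows of `μ`. -/
def padded (μ : YoungDiagram) (n : ℕ) (h : μ.card + μ.rowLen 0 ≤ n) : YoungDiagram where
  cells := (Finset.range (n - μ.card)).map ⟨fun j => (0, j), fun _ _ e => (Prod.ext_iff.1 e).2⟩ ∪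
    μ.cells.map ⟨fun c => (c.1 + 1, c.2), fun a b e => by
      obtain ⟨h1, h2⟩ := Prod.ext_iff.1 e
      exact Prod.ext (Nat.succ_injective h1) h2⟩
  isLowerSet := by
    rintro ⟨i, j⟩ ⟨i', j'⟩ ⟨hi, hj⟩ hc
    simp only [Finset.coe_union, Set.mem_union, Finset.mem_coe, Finset.mem_map, Finset.mem_range,
      YoungDiagram.mem_cells] at hc ⊢
    simp only at hi hj
    rcases hc with ⟨a, ha, he⟩ | ⟨⟨a, b⟩, hc, he⟩
    · obtain ⟨h1, h2⟩ := Prod.ext_iff.1 he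
      change 0 = i at h1; change a = j at h2
      exact Or.inl ⟨j', by omega, Prod.ext (show 0 = i' by omega) rfl⟩
    · obtain ⟨h1, h2⟩ := Prod.ext_iff.1 he
      change a + 1 = i at h1; change b = j at h2
      rcases i' with _ | i'
      · have h0 : (0, b) ∈ μ := μ.up_left_mem (Nat.zero_le a) le_rfl hc
        have := YoungDiagram.mem_iff_lt_rowLen.1 h0
        exact Or.inl ⟨j', by omega, rfl⟩
      · exact Or.inr ⟨(i', j'), μ.up_left_mem (by omega) (by omega) hc, rfl⟩

theorem padded_card (μ : YoungDiagram) (n : ℕ) (h : μ.card + μ.rowLen 0 ≤ n) :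
    (padded μ n h).card = n := by
  rw [YoungDiagram.card, padded, Finset.card_union_of_disjoint]
  · simp only [Finset.card_map, Finset.card_range]
    exact Nat.sub_add_cancel (by omega)
  · rw [Finset.disjoint_left]
    intro c h1 h2
    obtain ⟨_, _, h1⟩ := Finset.mem_map.1 h1
    obtain ⟨_, _, h2⟩ := Finset.mem_map.1 h2
    have := (Prod.ext_iff.1 (h1.trans h2.symm)).1
    simp at this

/-- `V(μ)_n = V_{μ[n]}`, defined for `n ≥ |μ| + μ₁`. -/
def paddedIrrep (μ : YoungDiagram) (n : ℕ) (h : μ.card + μ.rowLen 0 ≤ n) : Ideal (QS n) :=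
  irrep (padded μ n h) (padded_card μ n h)

/-! ### Consistent sequences of `S_n`-representations -/

/-- The natural inclusion `S_n ↪ S_{n+1}` as the stabilizer of the last point. -/
def permIncl (n : ℕ) : Equiv.Perm (Fin n) →* Equiv.Perm (Fin (n + 1)) :=
  Equiv.Perm.viaEmbeddingHom Fin.castSuccEmb

/-- A consistent sequence of rational `S_n`-representations. The sequences of interest start at
`n = 1`; the term at `n = 0` is padding (it may be taken to be zero), and no notion below
looks at it. -/
structure ConsistentSeq where
  V : ℕ → Type
  [addCommGroup : ∀ n, AddCommGroup (V n)]
  [module : ∀ n, Module ℚ (V n)]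
  /-- the `S_n`-action on `V n` -/
  ρ : ∀ n, Representation ℚ (Equiv.Perm (Fin n)) (V n)
  φ : ∀ n, V n →ₗ[ℚ] V (n + 1)
  φ_equivariant : ∀ n (σ : Equiv.Perm (Fin n)) (v : V n),
    φ n (ρ n σ v) = ρ (n + 1) (permIncl n σ) (φ n v)

attribute [instance] ConsistentSeq.addCommGroup ConsistentSeq.module

namespace ConsistentSeq

variable (X : ConsistentSeq)

/-- `V n` as a module over the group algebra `ℚ[S_n]`. -/
abbrev mod (n : ℕ) : Type := (X.ρ n).asModule

/-- The map `φ n`, on the underlying sets of the `ℚ[S_n]`- and `ℚ[S_{n+1}]`-modules. -/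
def φMod (n : ℕ) (v : X.mod n) : X.mod (n + 1) :=
  (X.ρ (n + 1)).asModuleEquiv.symm (X.φ n ((X.ρ n).asModuleEquiv v))

/-- The `S_{n+1}`-span of `φ n (W)`. -/
def spanImage (n : ℕ) (W : Submodule (QS n) (X.mod n)) : Submodule (QS (n + 1)) (X.mod (n + 1)) :=
  Submodule.span (QS (n + 1)) (X.φMod n '' (W : Set (X.mod n)))

open Classical in
/-- The multiplicity `c_μ(V n)` of the irreducible representation `V(μ)_n` in `V n`, that is, the
length of the `V(μ)_n`-isotypic component of `V n`. It is zero if `V(μ)_n` is not defined. -/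
def mult (μ : YoungDiagram) (n : ℕ) : ℕ∞ :=
  if h : μ.card + μ.rowLen 0 ≤ n then
    Module.length (QS n) (isotypicComponent (QS n) (X.mod n) (paddedIrrep μ n h))
  else 0

/-- Uniform representation stability with stable range `n ≥ N`. -/
structure UniformlyRepStable (N : ℕ) : Prop where
  finiteDimensional : ∀ n, 1 ≤ n → FiniteDimensional ℚ (X.V n)
  injective : ∀ n, 1 ≤ n → N ≤ n → Function.Injective (X.φ n)
  surjective : ∀ n, 1 ≤ n → N ≤ n → X.spanImage n ⊤ = ⊤
  mult_stable : ∀ (μ : YoungDiagram) (m n : ℕ), 1 ≤ m → N ≤ m → 1 ≤ n → N ≤ n →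
    X.mult μ m = X.mult μ n

/-- Monotonicity for `n ≥ N`: the `φ n` are injective and, for every subrepresentation `W` of
`V n` isomorphic to `V(μ)_n^{⊕k}`, the `S_{n+1}`-span of `φ n (W)` contains a copy of
`V(μ)_{n+1}^{⊕k}`. -/
structure Monotone (N : ℕ) : Prop where
  injective : ∀ n, 1 ≤ n → N ≤ n → Function.Injective (X.φ n)
  span_contains : ∀ n, 1 ≤ n → N ≤ n →
    ∀ (μ : YoungDiagram) (h : μ.card + μ.rowLen 0 ≤ n) (k : ℕ) (W : Submodule (QS n) (X.mod n)),
      Nonempty (W ≃ₗ[QS n] (Fin k → paddedIrrep μ n h)) →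
      ∃ W' : Submodule (QS (n + 1)) (X.mod (n + 1)), W' ≤ X.spanImage n W ∧
        Nonempty (W' ≃ₗ[QS (n + 1)] (Fin k → paddedIrrep μ (n + 1) (Nat.le_succ_of_le h)))

end ConsistentSeq

/-! ### Compatible `G`-actions and cohomology -/

/-- A consistent sequence compatible with `G`-actions: every `V n` is a `G`-module, the `G`-action
commutes with the `S_n`-action, and the maps `φ n` are `G`-maps. (An additive action on a rational
vector space is automatically `ℚ`-linear.) -/
structure CompatibleSeq (G : Type) [Group G] extends ConsistentSeq where
  τ : ∀ n, Representation ℚ G (V n)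
  comm : ∀ n (g : G) (σ : Equiv.Perm (Fin n)) (v : V n), τ n g (ρ n σ v) = ρ n σ (τ n g v)
  φ_comm : ∀ n (g : G) (v : V n), φ n (τ n g v) = τ (n + 1) g (φ n v)

namespace CompatibleSeq

variable {G : Type} [Group G] (X : CompatibleSeq G)

/-- `V n` as a `G`-representation. -/
abbrev rep (n : ℕ) : Rep.{0} ℚ G := Rep.of (X.τ n)

/-- The action of `σ ∈ S_n` on `V n`, as an endomorphism of the `G`-representation `V n`. -/
def permHom (n : ℕ) (σ : Equiv.Perm (Fin n)) : X.rep n ⟶ X.rep n :=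
  Rep.ofHom ⟨X.ρ n σ, fun g => LinearMap.ext fun v => (X.comm n g σ v).symm⟩

/-- `φ n` as a morphism of `G`-representations. -/
def φHom (n : ℕ) : X.rep n ⟶ X.rep (n + 1) :=
  Rep.ofHom ⟨X.φ n, fun g => LinearMap.ext fun v => X.φ_comm n g v⟩

/-- The consistent sequence `H^p(G; V n)`: the `S_n`-action and the maps `φ n^*` are the ones
induced by the `S_n`-action on the coefficients and by the maps `φ n`. -/
def cohomology (p : ℕ) : ConsistentSeq where
  V n := groupCohomology (X.rep n) p
  ρ n :=
    { toFun := fun σ => (groupCohomology.map (MonoidHom.id G) (X.permHom n σ) p).hom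
      map_one' := by
        have h : X.permHom n 1 = CategoryTheory.CategoryStruct.id _ := by
          ext v; simp [permHom]
        rw [h, groupCohomology.map_id]; rfl
      map_mul' := fun σ σ' => by
        have h : X.permHom n (σ * σ') =
            CategoryTheory.CategoryStruct.comp (X.permHom n σ') (X.permHom n σ) := by
          ext v; simp [permHom]
        rw [h, groupCohomology.map_id_comp]; rfl }
  φ n := (groupCohomology.map (MonoidHom.id G) (X.φHom n) p).hom
  φ_equivariant n σ v := by
    have h : CategoryTheory.CategoryStruct.comp (X.permHom n σ) (X.φHom n) =
        CategoryTheory.CategoryStruct.comp (X.φHom n) (X.permHom (n + 1) (permIncl n σ)) := by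
      ext v; simp [permHom, φHom, X.φ_equivariant]
    have h' := congrArg (fun f : X.rep n ⟶ X.rep (n + 1) =>
      groupCohomology.map (A := X.rep n) (MonoidHom.id G) f p) h
    simp only [groupCohomology.map_id_comp] at h'
    exact congrArg (fun f => f.hom v) h'

end CompatibleSeq

end RepStab

end

/-! Both hypotheses and conclusion are translated into relations between operators, which any
`ℚ`-linear functor preserves. For a tableau `T` of shape `μ[n]` with Young symmetrizer `c_T`, the
multiplicity of `V(μ)_n` in `V n` is the dimension of `c_T V_n` (`length_isotypicComponent`),
because `c_T` is idempotent up to a nonzero scalar and `c_T ℚ[S_n] c_T = ℚ c_T`.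

Let `U` extend `T` by a box at the end of the first row. That box is alone in its column, so `T` and
`U` have the same column antisymmetrizer and `c_U x c_T` lies in `ℚ c_U` for all `x`
(`ExtendsTableau.exists_mul_mul_algIncl`). If `W` is generated by `c_T V_n`, then `c_U` maps the
span of `φ(W)` into `c_U φ(c_T V_n)`. Monotonicity and equality of multiplicities therefore force `v
↦ c_U φ(v)` to be an isomorphism from `c_T V_n` to `c_U V_{n+1}` (`youngStable_of_monotone`).
Conversely, these isomorphisms, together with the vanishing of the shapes that first appear at `n +
1`, give injectivity, generation, stable multiplicities and monotonicity. This uses completeness: a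
module killed by one symmetrizer of each shape is zero (`eq_zero_of_youngSymmetrizer_smul_eq_zero`).

The inverse isomorphism commutes with `G`, so `YoungStable` amounts to identities between morphisms
of `G`-representations (`exists_inverse`), and these survive in `H^p` (`cohomology_youngStable`).
Type `FP_∞` serves only to make cohomology finite-dimensional, through the rationalized resolution.
-/

open scoped MonoidAlgebra CategoryTheory

noncomputable section

namespace RepStab

/-! ### Combinatorics of tableaux: dominance and row-column factorization. -/

section Tableaux

open Finset

variable {n : ℕ} {μ ν : YoungDiagram}

/-- The number of entries in a set of boxes only depends on the shape. -/
theorem card_tableau_filter (T : Fin n ≃ μ.cells) (p : ℕ × ℕ → Prop) [DecidablePred p] :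
    #{i | p (T i).1} = #{c ∈ μ.cells | p c} := by
  refine card_bij (fun i _ => (T i).1) (fun i hi => ?_) (fun i _ j _ h => ?_) fun c hc => ?_
  · simpa using hi
  · exact T.injective (Subtype.ext h)
  · rw [mem_filter] at hc
    exact ⟨T.symm ⟨c, hc.1⟩, by simpa using hc.2, by simp⟩

theorem card_cells_filter_row_lt_col (μ : YoungDiagram) (k j : ℕ) :
    #{c ∈ μ.cells | c.1 < k ∧ c.2 = j} = min k (μ.colLen j) := by
  have : {c ∈ μ.cells | c.1 < k ∧ c.2 = j} = range (min k (μ.colLen j)) ×ˢ {j} := by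
    ext ⟨a, b⟩
    simp only [mem_filter, YoungDiagram.mem_cells, YoungDiagram.mem_iff_lt_colLen, mem_product,
      mem_range, mem_singleton, lt_min_iff]
    constructor
    · rintro ⟨h1, h2, rfl⟩
      exact ⟨⟨h2, h1⟩, rfl⟩
    · rintro ⟨⟨h2, h1⟩, rfl⟩
      exact ⟨h1, h2, rfl⟩
  rw [this, card_product, card_range, card_singleton, mul_one]

/-- No two entries lie in the same row of `T` and in the same column of `U`. -/
def RowColDisjoint (T : Fin n ≃ μ.cells) (U : Fin n ≃ ν.cells) : Prop :=
  ∀ i j, (T i).1.1 = (T j).1.1 → (U i).1.2 = (U j).1.2 → i = j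

/-- The entries of column `j` of `U` lie in distinct rows of `T`, so at most `k` of them are in the
first `k` rows, and at most the column length in all. Column `j` of `U` itself attains the smaller
of these two bounds. -/
theorem RowColDisjoint.card_le {T : Fin n ≃ μ.cells} {U : Fin n ≃ ν.cells}
    (h : RowColDisjoint T U) (k j : ℕ) :
    #{i | (T i).1.1 < k ∧ (U i).1.2 = j} ≤ #{i | (U i).1.1 < k ∧ (U i).1.2 = j} := by
  rw [card_tableau_filter U (fun c => c.1 < k ∧ c.2 = j), card_cells_filter_row_lt_col, le_min_iff]
  constructor
  · rw [← card_range k]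
    refine card_le_card_of_injOn (fun i => (T i).1.1) (fun i hi => ?_) fun i hi i' hi' he => ?_
    · have := (mem_filter.1 hi).2.1
      simpa using this
    · have h1 := (mem_filter.1 hi).2.2
      have h2 := (mem_filter.1 hi').2.2
      exact h i i' he (h1.trans h2.symm)
  · rw [YoungDiagram.colLen_eq_card, YoungDiagram.col, ← card_tableau_filter U (fun c => c.2 = j)]
    exact card_le_card fun i hi => by
      simp only [mem_filter] at hi ⊢
      exact ⟨hi.1, hi.2.2⟩

theorem card_row_lt_eq_sum (T : Fin n ≃ μ.cells) (U : Fin n ≃ ν.cells) (k : ℕ) :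
    #{i | (T i).1.1 < k} =
      ∑ j ∈ univ.image fun i => (U i).1.2, #{i | (T i).1.1 < k ∧ (U i).1.2 = j} := by
  rw [card_eq_sum_card_fiberwise (f := fun i => (U i).1.2) (t := univ.image fun i => (U i).1.2)]
  · simp only [filter_filter]
  · intro i _
    simp

/-- The dominance inequality. -/
theorem RowColDisjoint.card_row_lt_le {T : Fin n ≃ μ.cells} {U : Fin n ≃ ν.cells}
    (h : RowColDisjoint T U) (k : ℕ) :
    #{c ∈ μ.cells | c.1 < k} ≤ #{c ∈ ν.cells | c.1 < k} := by
  rw [← card_tableau_filter T (fun c => c.1 < k), ← card_tableau_filter U (fun c => c.1 < k),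
    card_row_lt_eq_sum T U, card_row_lt_eq_sum U U]
  exact sum_le_sum fun j _ => h.card_le k j

/-- This is the equality case of dominance. With equal shapes the columnwise inequalities add up to
an equality, so each is one. Taking `k` to be the length of column `j` puts that whole column of `U`
in the first `k` rows of `T`. -/
theorem RowColDisjoint.mem {T U : Fin n ≃ μ.cells} (h : RowColDisjoint T U) (i : Fin n) :
    ((T i).1.1, (U i).1.2) ∈ μ := by
  set j := (U i).1.2 with hj
  set k := μ.colLen j with hk
  rw [YoungDiagram.mem_iff_lt_colLen, ← hk]
  have hsum : ∑ j ∈ univ.image fun i => (U i).1.2, #{i | (T i).1.1 < k ∧ (U i).1.2 = j} =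
      ∑ j ∈ univ.image fun i => (U i).1.2, #{i | (U i).1.1 < k ∧ (U i).1.2 = j} := by
    rw [← card_row_lt_eq_sum T U, ← card_row_lt_eq_sum U U,
      card_tableau_filter T (fun c => c.1 < k), card_tableau_filter U (fun c => c.1 < k)]
  have heq := (sum_eq_sum_iff_of_le fun j _ => h.card_le k j).1 hsum j
    (mem_image_of_mem _ (mem_univ i))
  rw [card_tableau_filter U (fun c => c.1 < k ∧ c.2 = j), card_cells_filter_row_lt_col, ← hk,
    min_self] at heq
  have hcol : #{i | (U i).1.2 = j} = k := by
    rw [hk, YoungDiagram.colLen_eq_card, YoungDiagram.col,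
      ← card_tableau_filter U (fun c => c.2 = j)]
  have hs := eq_of_subset_of_card_le (s := {i | (T i).1.1 < k ∧ (U i).1.2 = j})
    (t := {i | (U i).1.2 = j}) (fun i hi => by
      simp only [mem_filter] at hi ⊢
      exact ⟨hi.1, hi.2.2⟩) (by rw [heq, hcol])
  have : i ∈ ({i | (T i).1.1 < k ∧ (U i).1.2 = j} : Finset (Fin n)) := by
    rw [hs]
    simp [hj]
  exact (mem_filter.1 this).2.1

theorem eq_of_card_row_lt_eq (h : ∀ k, #{c ∈ μ.cells | c.1 < k} = #{c ∈ ν.cells | c.1 < k}) :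
    μ = ν := by
  have key : ∀ (ν : YoungDiagram) (k : ℕ),
      #{c ∈ ν.cells | c.1 < k + 1} = #{c ∈ ν.cells | c.1 < k} + ν.rowLen k := by
    intro ν k
    rw [YoungDiagram.rowLen_eq_card, YoungDiagram.row, ← card_union_of_disjoint]
    · congr 1
      ext c
      simp only [mem_filter, mem_union]
      constructor
      · rintro ⟨h1, h2⟩
        rcases Nat.lt_succ_iff_lt_or_eq.1 h2 with h3 | h3
        exacts [Or.inl ⟨h1, h3⟩, Or.inr ⟨h1, h3⟩]
      · rintro (⟨h1, h2⟩ | ⟨h1, h2⟩)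
        exacts [⟨h1, by omega⟩, ⟨h1, by omega⟩]
    · rw [disjoint_left]
      intro c h1 h2
      have h3 := (mem_filter.1 h1).2
      have h4 := (mem_filter.1 h2).2
      omega
  have hr : ∀ k, μ.rowLen k = ν.rowLen k := fun k => by
    have h1 := key μ k
    have h2 := key ν k
    have h3 := h k
    have h4 := h (k + 1)
    omega
  ext ⟨i, j⟩
  simp only [YoungDiagram.mem_cells, YoungDiagram.mem_iff_lt_rowLen, hr]

/-- If no two entries lie in the same row of `T` and in the same column of `T ∘ g⁻¹`, then `g` is
the product of a row permutation and a column permutation. -/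
theorem RowColDisjoint.exists_factorization {T : Fin n ≃ μ.cells} {g : Equiv.Perm (Fin n)}
    (h : RowColDisjoint T (g⁻¹.trans T)) :
    ∃ r c : Equiv.Perm (Fin n), (∀ i, (T (r i)).1.1 = (T i).1.1) ∧
      (∀ i, (T (c i)).1.2 = (T i).1.2) ∧ g = r * c := by
  -- The box in the row of `i` and the column of `g⁻¹ i`. Moving `i` there changes only its column,
  -- and following `g` by this move restores the original column.
  let f : Fin n → μ.cells := fun i =>
    ⟨((T i).1.1, ((g⁻¹.trans T) i).1.2), (YoungDiagram.mem_cells _).2 (h.mem i)⟩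
  have hf : Function.Injective f := fun i j hij => by
    have := Subtype.ext_iff.1 hij
    exact h i j (Prod.ext_iff.1 this).1 (Prod.ext_iff.1 this).2
  have hs : Function.Injective fun i => T.symm (f i) := T.symm.injective.comp hf
  let r : Equiv.Perm (Fin n) := Equiv.ofBijective _ (Finite.injective_iff_bijective.1 hs)
  have hr : ∀ i, T (r i) = f i := fun i => T.apply_symm_apply _
  refine ⟨r⁻¹, r * g, fun i => ?_, fun i => ?_, by simp⟩
  · have := hr (r⁻¹ i)
    rw [← Equiv.Perm.mul_apply, mul_inv_cancel, Equiv.Perm.one_apply] at this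
    rw [this]
  · rw [Equiv.Perm.mul_apply, hr]
    simp [f]

end Tableaux

/-! ### Products of row and column symmetrizers. -/

section Symmetrizers

open Finset MonoidAlgebra

variable {n : ℕ} {μ ν : YoungDiagram}

/-- The sum of the permutations preserving every row of `T`. -/
def rowSym (T : Fin n ≃ μ.cells) : QS n :=
  ∑ g : Equiv.Perm (Fin n) with ∀ i, (T (g i)).1.1 = (T i).1.1, single g (1 : ℚ)

/-- The signed sum of the permutations preserving every column of `T`. -/
def colSym (T : Fin n ≃ μ.cells) : QS n :=
  ∑ g : Equiv.Perm (Fin n) with ∀ i, (T (g i)).1.2 = (T i).1.2,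
    single g (((Equiv.Perm.sign g : ℤˣ) : ℤ) : ℚ)

theorem youngSymmetrizer_eq (T : Fin n ≃ μ.cells) : youngSymmetrizer T = rowSym T * colSym T := rfl

theorem rowSym_mul_single (T : Fin n ≃ μ.cells) {g : Equiv.Perm (Fin n)}
    (hg : ∀ i, (T (g i)).1.1 = (T i).1.1) : rowSym T * single g 1 = rowSym T := by
  rw [rowSym, sum_mul]
  simp only [single_mul_single, mul_one]
  refine sum_bij' (fun h _ => h * g) (fun h _ => h * g⁻¹) (fun h hh => ?_) (fun h hh => ?_)
    (fun h _ => by simp) (fun h _ => by simp) fun h _ => rfl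
  · simp only [mem_filter, mem_univ, true_and] at hh ⊢
    intro i
    rw [Equiv.Perm.mul_apply, hh, hg]
  · simp only [mem_filter, mem_univ, true_and] at hh ⊢
    intro i
    rw [Equiv.Perm.mul_apply, hh, ← hg]
    simp

theorem single_mul_colSym (T : Fin n ≃ μ.cells) {g : Equiv.Perm (Fin n)}
    (hg : ∀ i, (T (g i)).1.2 = (T i).1.2) :
    single g 1 * colSym T = (((Equiv.Perm.sign g : ℤˣ) : ℤ) : ℚ) • colSym T := by
  rw [colSym, mul_sum, smul_sum]
  simp only [single_mul_single, one_mul, smul_single, smul_eq_mul]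
  refine sum_bij' (fun h _ => g * h) (fun h _ => g⁻¹ * h) (fun h hh => ?_) (fun h hh => ?_)
    (fun h _ => by simp) (fun h _ => by simp) fun h _ => ?_
  · simp only [mem_filter, mem_univ, true_and] at hh ⊢
    intro i
    rw [Equiv.Perm.mul_apply, hg, hh]
  · simp only [mem_filter, mem_univ, true_and] at hh ⊢
    intro i
    rw [Equiv.Perm.mul_apply, ← hh i, ← hg]
    simp
  · congr 1
    rw [← Int.cast_mul, ← Units.val_mul, Equiv.Perm.sign_mul, ← mul_assoc, Int.units_mul_self,
      one_mul]

theorem single_mul_rowSym (T : Fin n ≃ μ.cells) (g : Equiv.Perm (Fin n)) :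
    single g 1 * rowSym T = rowSym (g⁻¹.trans T) * single g 1 := by
  rw [rowSym, rowSym, mul_sum, sum_mul]
  simp only [single_mul_single, one_mul]
  refine sum_bij' (fun h _ => g * h * g⁻¹) (fun h _ => g⁻¹ * h * g) (fun h hh => ?_)
    (fun h hh => ?_) (fun h _ => by group) (fun h _ => by group) fun h _ => by simp
  · simp only [mem_filter, mem_univ, true_and] at hh ⊢
    intro i
    simp [hh]
  · simp only [mem_filter, mem_univ, true_and] at hh ⊢
    intro i
    simpa using hh (g i)

theorem single_mul_colSym' (T : Fin n ≃ μ.cells) (g : Equiv.Perm (Fin n)) :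
    single g 1 * colSym T = colSym (g⁻¹.trans T) * single g 1 := by
  have hsign : ∀ h : Equiv.Perm (Fin n), Equiv.Perm.sign (g * h * g⁻¹) = Equiv.Perm.sign h :=
    fun h => by
      rw [Equiv.Perm.sign_mul, Equiv.Perm.sign_mul, Equiv.Perm.sign_inv, mul_right_comm,
        Int.units_mul_self, one_mul]
  rw [colSym, colSym, mul_sum, sum_mul]
  simp only [single_mul_single, one_mul, mul_one]
  refine sum_bij' (fun h _ => g * h * g⁻¹) (fun h _ => g⁻¹ * h * g) (fun h hh => ?_)
    (fun h hh => ?_) (fun h _ => by group) (fun h _ => by group) fun h _ => by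
      rw [hsign, inv_mul_cancel_right]
  · simp only [mem_filter, mem_univ, true_and] at hh ⊢
    intro i
    simp [hh]
  · simp only [mem_filter, mem_univ, true_and] at hh ⊢
    intro i
    simpa using hh (g i)

theorem single_mul_youngSymmetrizer (T : Fin n ≃ μ.cells) (g : Equiv.Perm (Fin n)) :
    single g 1 * youngSymmetrizer T = youngSymmetrizer (g⁻¹.trans T) * single g 1 := by
  rw [youngSymmetrizer_eq, youngSymmetrizer_eq, ← mul_assoc, single_mul_rowSym, mul_assoc,
    single_mul_colSym', mul_assoc]

/-- The transposition of two entries sharing a row of `T` and a column of `U` is absorbed by the row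
sum with sign `+` and by the column sum with sign `-`. -/
theorem rowSym_mul_colSym_eq_zero {T : Fin n ≃ μ.cells} {U : Fin n ≃ ν.cells}
    (h : ¬RowColDisjoint T U) : rowSym T * colSym U = 0 := by
  simp only [RowColDisjoint, not_forall] at h
  obtain ⟨i, j, hT, hU, hij⟩ := h
  have h1 : rowSym T * single (Equiv.swap i j) 1 = rowSym T := rowSym_mul_single T fun l => by
    by_cases hi : l = i
    · rw [hi, Equiv.swap_apply_left, hT]
    · by_cases hj : l = j
      · rw [hj, Equiv.swap_apply_right, hT]
      · rw [Equiv.swap_apply_of_ne_of_ne hi hj]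
  have h2 := single_mul_colSym U (g := Equiv.swap i j) fun l => by
    by_cases hi : l = i
    · rw [hi, Equiv.swap_apply_left, hU]
    · by_cases hj : l = j
      · rw [hj, Equiv.swap_apply_right, hU]
      · rw [Equiv.swap_apply_of_ne_of_ne hi hj]
  rw [Equiv.Perm.sign_swap hij] at h2
  have h3 : rowSym T * colSym U = -(rowSym T * colSym U) := by
    conv_lhs => rw [← h1, mul_assoc, h2]
    simp
  have h4 : (2 : ℚ) • (rowSym T * colSym U) = 0 := by
    rw [two_smul]
    exact eq_neg_iff_add_eq_zero.1 h3
  exact (smul_eq_zero.1 h4).resolve_left two_ne_zero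

theorem eq_sum_smul_single {G : Type*} [Fintype G] (x : ℚ[G]) :
    x = ∑ g, x.coeff g • single g (1 : ℚ) := by
  ext h
  simp [coeff_sum]

/-- It suffices to take `x` a permutation `g`. Either `g` is a row permutation times a column
permutation, both of which are absorbed up to sign, or the product vanishes. -/
theorem exists_rowSym_mul_mul_colSym (T : Fin n ≃ μ.cells) (x : QS n) :
    ∃ q : ℚ, rowSym T * x * colSym T = q • youngSymmetrizer T := by
  have key : ∀ g : Equiv.Perm (Fin n),
      ∃ q : ℚ, rowSym T * single g 1 * colSym T = q • youngSymmetrizer T := fun g => by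
    by_cases h : RowColDisjoint T (g⁻¹.trans T)
    · obtain ⟨r, c, hr, hc, rfl⟩ := h.exists_factorization
      refine ⟨((Equiv.Perm.sign c : ℤˣ) : ℤ), ?_⟩
      rw [← one_mul (1 : ℚ), ← single_mul_single, ← mul_assoc, rowSym_mul_single T hr, mul_assoc,
        single_mul_colSym T hc, mul_smul_comm, youngSymmetrizer_eq]
    · refine ⟨0, ?_⟩
      rw [mul_assoc, single_mul_colSym', ← mul_assoc, rowSym_mul_colSym_eq_zero h, zero_mul,
        zero_smul]
  choose q hq using key
  refine ⟨∑ g, x.coeff g * q g, ?_⟩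
  conv_lhs => rw [eq_sum_smul_single x]
  simp only [mul_sum, sum_mul, mul_smul_comm, smul_mul_assoc, hq, smul_smul, sum_smul]

theorem exists_youngSymmetrizer_mul_mul (T : Fin n ≃ μ.cells) (x : QS n) :
    ∃ q : ℚ, youngSymmetrizer T * x * youngSymmetrizer T = q • youngSymmetrizer T := by
  obtain ⟨q, hq⟩ := exists_rowSym_mul_mul_colSym T (colSym T * x * rowSym T)
  exact ⟨q, by rw [← hq, youngSymmetrizer_eq]; simp only [mul_assoc]⟩

/-- If neither alternative held, each shape would dominate the other. Vanishing on one side is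
enough later, since the central elements built from symmetrizers commute. -/
theorem youngSymmetrizer_mul_mul_eq_zero_or (T : Fin n ≃ μ.cells) (U : Fin n ≃ ν.cells)
    (h : μ ≠ ν) : (∀ x, youngSymmetrizer T * x * youngSymmetrizer U = 0) ∨
      ∀ x, youngSymmetrizer U * x * youngSymmetrizer T = 0 := by
  have key : ∀ {μ ν : YoungDiagram} (T : Fin n ≃ μ.cells) (U : Fin n ≃ ν.cells),
      (∀ g : Equiv.Perm (Fin n), ¬RowColDisjoint T (g⁻¹.trans U)) →
      ∀ x, youngSymmetrizer T * x * youngSymmetrizer U = 0 := by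
    intro μ ν T U h x
    have h' : ∀ y, rowSym T * y * colSym U = 0 := fun y => by
      rw [eq_sum_smul_single y]
      simp only [mul_sum, sum_mul, mul_smul_comm, smul_mul_assoc]
      refine sum_eq_zero fun g _ => ?_
      rw [mul_assoc, single_mul_colSym', ← mul_assoc, rowSym_mul_colSym_eq_zero (h g), zero_mul,
        smul_zero]
    rw [← h' (colSym T * x * rowSym U), youngSymmetrizer_eq, youngSymmetrizer_eq]
    simp only [mul_assoc]
  by_cases h1 : ∀ g : Equiv.Perm (Fin n), ¬RowColDisjoint T (g⁻¹.trans U)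
  · exact Or.inl (key T U h1)
  by_cases h2 : ∀ g : Equiv.Perm (Fin n), ¬RowColDisjoint U (g⁻¹.trans T)
  · exact Or.inr (key U T h2)
  push Not at h1 h2
  obtain ⟨g, hg⟩ := h1
  obtain ⟨g', hg'⟩ := h2
  exact (h (eq_of_card_row_lt_eq fun k => (hg.card_row_lt_le k).antisymm
    (hg'.card_row_lt_le k))).elim

/-- A permutation preserving both rows and columns of a tableau is the identity, so only the pair
`(1, 1)` contributes. -/
theorem coeff_youngSymmetrizer_one (T : Fin n ≃ μ.cells) : (youngSymmetrizer T).coeff 1 = 1 := by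
  rw [youngSymmetrizer, sum_mul_sum]
  simp only [single_mul_single, one_mul, coeff_sum, coeff_single, Finsupp.finsetSum_apply]
  rw [sum_eq_single 1, sum_eq_single 1]
  · simp
  · intro h _ hh
    rw [one_mul, Finsupp.single_eq_of_ne hh.symm]
  · intro h
    simp at h
  · intro g hg hg1
    refine sum_eq_zero fun h hh => Finsupp.single_eq_of_ne fun hgh => hg1 ?_
    simp only [mem_filter, mem_univ, true_and] at hg hh
    have hgi : h = g⁻¹ := (inv_eq_of_mul_eq_one_right hgh.symm).symm
    ext1 i
    apply T.injective
    apply Subtype.ext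
    refine Prod.ext (hg i) ?_
    have := hh (g i)
    rw [hgi] at this
    simpa using this.symm
  · intro h
    simp at h

end Symmetrizers

/-! ### Nilpotent elements of a rational group algebra. -/

section Nilpotent

open MonoidAlgebra

variable {G : Type*} [Group G] [Fintype G]

/-- Left multiplication by `x` has trace `|G|` times the coefficient at `1`, and a nilpotent
operator has trace zero. -/
theorem coeff_one_eq_zero_of_isNilpotent {x : ℚ[G]} (hx : IsNilpotent x) : x.coeff 1 = 0 := by
  classical
  let b : Module.Basis G ℚ ℚ[G] := .ofRepr (coeffLinearEquiv ℚ)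
  have h1 : IsNilpotent (LinearMap.mulLeft ℚ x) := by
    obtain ⟨k, hk⟩ := hx
    exact ⟨k, by rw [LinearMap.pow_mulLeft, hk, LinearMap.mulLeft_zero_eq_zero]⟩
  have h2 := (LinearMap.isNilpotent_trace_of_isNilpotent h1).eq_zero
  rw [LinearMap.trace_eq_matrix_trace ℚ b, Matrix.trace] at h2
  have h3 : ∀ g, (LinearMap.toMatrix b b (LinearMap.mulLeft ℚ x)).diag g = x.coeff 1 := fun g => by
    have hb : b g = single g 1 := rfl
    rw [Matrix.diag_apply, LinearMap.toMatrix_apply, hb, LinearMap.mulLeft_apply]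
    change (x * single g 1).coeff g = _
    simp [coeff_mul_single_apply]
  simp only [h3, Finset.sum_const, nsmul_eq_mul, mul_eq_zero] at h2
  simpa using h2

/-- Each `x g⁻¹` squares to zero, and its coefficient at `1` is the coefficient of `x` at `g`. -/
theorem eq_zero_of_forall_mul_mul_self_eq_zero {x : ℚ[G]} (h : ∀ y, x * y * x = 0) : x = 0 := by
  ext g
  have h1 : IsNilpotent (x * single g⁻¹ 1) := ⟨2, by rw [sq, ← mul_assoc, h, zero_mul]⟩
  simpa [coeff_mul_single_apply] using coeff_one_eq_zero_of_isNilpotent h1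

end Nilpotent

/-! ### Idempotence of Young symmetrizers up to scale. -/

section Idempotents

open MonoidAlgebra

variable {n : ℕ} {μ ν : YoungDiagram}

/-- The scalar is nonzero because otherwise the symmetrizer would be nilpotent with coefficient `1`
at the identity. -/
theorem exists_youngSymmetrizer_mul_self (T : Fin n ≃ μ.cells) :
    ∃ s : ℚ, s ≠ 0 ∧ youngSymmetrizer T * youngSymmetrizer T = s • youngSymmetrizer T := by
  obtain ⟨s, hs⟩ := exists_youngSymmetrizer_mul_mul T 1
  rw [mul_one] at hs
  refine ⟨s, ?_, hs⟩
  rintro rfl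
  have := coeff_one_eq_zero_of_isNilpotent (x := youngSymmetrizer T) ⟨2, by rw [sq, hs, zero_smul]⟩
  rw [coeff_youngSymmetrizer_one] at this
  exact one_ne_zero this

end Idempotents

/-! ### Completeness: the Young symmetrizers detect every module. -/

section Completeness

open Finset MonoidAlgebra

variable {n : ℕ} {μ ν : YoungDiagram}

theorem card_cellsOfRowLens (w : List ℕ) : #(YoungDiagram.cellsOfRowLens w) = w.sum := by
  induction w with
  | nil => rfl
  | cons a w ih =>
    rw [YoungDiagram.cellsOfRowLens, card_union_of_disjoint]
    · simp [ih]
    · rw [disjoint_left]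
      rintro ⟨i, j⟩ h1 h2
      simp only [mem_product, mem_singleton] at h1
      simp only [mem_map] at h2
      obtain ⟨x, -, hx⟩ := h2
      have := (Prod.ext_iff.1 hx).1
      simp [h1.1] at this

/-- The Young diagram of a partition. -/
def partitionDiagram (π : n.Partition) : YoungDiagram :=
  YoungDiagram.ofRowLens (π.parts.sort (· ≥ ·)) (π.parts.pairwise_sort (· ≥ ·)).sortedGE

theorem card_partitionDiagram (π : n.Partition) : (partitionDiagram π).card = n := by
  refine (card_cellsOfRowLens _).trans ?_
  rw [← Multiset.sum_coe, Multiset.sort_eq, π.parts_sum]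

theorem partitionDiagram_injective : Function.Injective (partitionDiagram (n := n)) := by
  intro π π' h
  have key : ∀ π : n.Partition, (partitionDiagram π).rowLens = π.parts.sort (· ≥ ·) := fun π =>
    YoungDiagram.rowLens_ofRowLens_eq_self fun x hx => π.parts_pos (by simpa using hx)
  have h1 := congrArg YoungDiagram.rowLens h
  rw [key, key] at h1
  have h2 := congrArg (fun l : List ℕ => (l : Multiset ℕ)) h1
  simp only [Multiset.sort_eq] at h2
  exact Nat.Partition.ext h2

/-- The sum of the conjugates of the Young symmetrizer. -/
def centralYoung (T : Fin n ≃ μ.cells) : QS n :=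
  ∑ g : Equiv.Perm (Fin n), single g 1 * youngSymmetrizer T * single g⁻¹ 1

theorem single_mul_centralYoung (T : Fin n ≃ μ.cells) (h : Equiv.Perm (Fin n)) :
    single h 1 * centralYoung T = centralYoung T * single h 1 := by
  rw [centralYoung, mul_sum, sum_mul]
  refine Fintype.sum_equiv (Equiv.mulLeft h) _ _ fun g => ?_
  simp only [Equiv.coe_mulLeft, mul_inv_rev]
  rw [mul_assoc _ (single (g⁻¹ * h⁻¹) 1), single_mul_single, inv_mul_cancel_right, ← mul_assoc,
    ← mul_assoc, single_mul_single, one_mul]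

theorem mul_centralYoung (T : Fin n ≃ μ.cells) (x : QS n) :
    x * centralYoung T = centralYoung T * x := by
  rw [eq_sum_smul_single x]
  simp only [mul_sum, sum_mul, smul_mul_assoc, mul_smul_comm, single_mul_centralYoung]

theorem coeff_centralYoung_conj (T : Fin n ≃ μ.cells) (g h : Equiv.Perm (Fin n)) :
    (centralYoung T).coeff (h * g * h⁻¹) = (centralYoung T).coeff g := by
  have := congrArg (fun x => x.coeff (h * g)) (single_mul_centralYoung T h)
  simp only [coeff_single_mul_apply, coeff_mul_single_apply, one_mul, mul_one,
    inv_mul_cancel_left] at this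
  exact this.symm

theorem coeff_centralYoung_one (T : Fin n ≃ μ.cells) : (centralYoung T).coeff 1 ≠ 0 := by
  have : (centralYoung T).coeff 1 = Fintype.card (Equiv.Perm (Fin n)) := by
    rw [centralYoung, coeff_sum, Finsupp.finsetSum_apply]
    simp only [coeff_mul_single_apply, coeff_single_mul_apply]
    simp [coeff_youngSymmetrizer_one]
  rw [this]
  exact Nat.cast_ne_zero.2 Fintype.card_ne_zero

/-- Being central, the element acts on the Young symmetrizer by a scalar, hence on every conjugate
by the same scalar. Its nonzero coefficient at `1` rules out nilpotency. -/
theorem exists_centralYoung_mul_self (T : Fin n ≃ μ.cells) :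
    ∃ q : ℚ, q ≠ 0 ∧ centralYoung T * centralYoung T = q • centralYoung T := by
  obtain ⟨s, hs, hcc⟩ := exists_youngSymmetrizer_mul_self T
  obtain ⟨q, hq⟩ := exists_youngSymmetrizer_mul_mul T (centralYoung T)
  have h1 : centralYoung T * youngSymmetrizer T = (s⁻¹ * q) • youngSymmetrizer T := by
    rw [mul_centralYoung, mul_assoc, hcc, mul_smul_comm] at hq
    rw [mul_smul, ← hq, inv_smul_smul₀ hs]
  have h2 : centralYoung T * centralYoung T = (s⁻¹ * q) • centralYoung T := by
    nth_rw 2 [centralYoung]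
    rw [mul_sum, centralYoung, smul_sum]
    refine sum_congr rfl fun g _ => ?_
    rw [← mul_assoc, ← mul_assoc, ← centralYoung, ← mul_centralYoung, mul_assoc (single g 1), h1,
      mul_smul_comm, smul_mul_assoc]
  refine ⟨_, ?_, h2⟩
  intro h0
  rw [h0, zero_smul, ← sq] at h2
  exact coeff_centralYoung_one T (coeff_one_eq_zero_of_isNilpotent ⟨2, h2⟩)

theorem centralYoung_mul_eq_zero (T : Fin n ≃ μ.cells) (U : Fin n ≃ ν.cells) (h : μ ≠ ν) :
    centralYoung T * centralYoung U = 0 := by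
  have key : ∀ {μ ν : YoungDiagram} (T : Fin n ≃ μ.cells) (U : Fin n ≃ ν.cells),
      (∀ x, youngSymmetrizer T * x * youngSymmetrizer U = 0) →
      centralYoung T * centralYoung U = 0 := by
    intro μ ν T U h
    rw [centralYoung, centralYoung, sum_mul_sum]
    refine sum_eq_zero fun g _ => sum_eq_zero fun g' _ => ?_
    have := h (single g⁻¹ 1 * single g' 1)
    calc _ = single g 1 * (youngSymmetrizer T * (single g⁻¹ 1 * single g' 1) *
          youngSymmetrizer U) * single g'⁻¹ 1 := by simp only [mul_assoc]
      _ = 0 := by rw [this, mul_zero, zero_mul]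
  rcases youngSymmetrizer_mul_mul_eq_zero_or T U h with h | h
  · exact key T U h
  · rw [mul_centralYoung]
    exact key U T h

/-- `1` is a linear combination of conjugates of Young symmetrizers. -/
theorem exists_sum_centralYoung_eq_one (T : ∀ π : (Fintype.card (Fin n)).Partition,
      Fin n ≃ (partitionDiagram π).cells) :
    ∃ a : (Fintype.card (Fin n)).Partition → ℚ, ∑ π, a π • centralYoung (T π) = 1 := by
  classical
  let Z : ((Fintype.card (Fin n)).Partition → ℚ) →ₗ[ℚ] QS n :=
    ∑ π, (LinearMap.toSpanSingleton ℚ _ (centralYoung (T π))) ∘ₗ LinearMap.proj π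
  have hZ : ∀ a, Z a = ∑ π, a π • centralYoung (T π) := fun a => by simp [Z]
  have hZinj : ∀ a, Z a = 0 → a = 0 := fun a ha => by
    ext π
    obtain ⟨q, hq, hqq⟩ := exists_centralYoung_mul_self (T π)
    have h1 := congrArg (· * centralYoung (T π)) ha
    simp only [hZ, sum_mul, zero_mul, smul_mul_assoc] at h1
    rw [sum_eq_single π (fun π' _ hπ => by
      rw [centralYoung_mul_eq_zero _ _ (partitionDiagram_injective.ne hπ), smul_zero])
      (fun h => (h (mem_univ _)).elim), hqq, smul_smul] at h1
    rcases smul_eq_zero.1 h1 with h2 | h2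
    · exact (mul_eq_zero.1 h2).resolve_right hq
    · exact (coeff_centralYoung_one (T π) (by rw [h2]; rfl)).elim
  -- A representative of each cycle type. The default value `1` is harmless: only partitions that
  -- arise from a permutation are used in `hr`.
  let r : (Fintype.card (Fin n)).Partition → Equiv.Perm (Fin n) := fun π =>
    if h : ∃ g : Equiv.Perm (Fin n), g.partition = π then h.choose else 1
  have hr : ∀ g : Equiv.Perm (Fin n), IsConj (r g.partition) g := fun g => by
    have h : ∃ h : Equiv.Perm (Fin n), h.partition = g.partition := ⟨g, rfl⟩
    rw [Equiv.Perm.partition_eq_of_isConj]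
    simp only [r, dif_pos h]
    exact h.choose_spec
  let E : QS n →ₗ[ℚ] ((Fintype.card (Fin n)).Partition → ℚ) :=
    LinearMap.pi fun π => (Finsupp.lapply (r π)) ∘ₗ (coeffLinearEquiv ℚ).toLinearMap
  have hE : ∀ x π, E x π = x.coeff (r π) := fun x π => rfl
  -- A class function is determined by its values on the representatives.
  have hEinj : ∀ x : QS n, (∀ g h, x.coeff (h * g * h⁻¹) = x.coeff g) → E x = 0 → x = 0 := by
    intro x hx h0
    ext g
    obtain ⟨h, hh⟩ := isConj_iff.1 (hr g)
    rw [← hh, hx, ← hE, h0]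
    rfl
  have hcl : ∀ a g h, (Z a).coeff (h * g * h⁻¹) = (Z a).coeff g := fun a g h => by
    simp only [hZ, coeff_sum, Finsupp.finsetSum_apply, coeff_smul_apply, coeff_centralYoung_conj]
  -- An injective endomorphism of the finite-dimensional space of functions on partitions is
  -- surjective, so some combination of the central elements agrees with the class function `1`.
  -- Indexing both shapes and conjugacy classes by partitions is what makes the dimensions match.
  have hinj : Function.Injective (E ∘ₗ Z) :=
    (injective_iff_map_eq_zero _).2 fun a ha => hZinj a (hEinj _ (hcl a) ha)
  obtain ⟨a, ha⟩ := LinearMap.injective_iff_surjective.1 hinj (E 1)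
  refine ⟨a, ?_⟩
  rw [← hZ, ← sub_eq_zero]
  refine hEinj _ (fun g h => ?_) ?_
  · rw [coeff_sub, Finsupp.sub_apply, Finsupp.sub_apply, hcl]
    congr 1
    simp [one_def, Finsupp.single_apply, eq_comm (a := (1 : Equiv.Perm (Fin n)))]
  · rw [map_sub, sub_eq_zero]
    exact ha

/-- A `ℚ[S_n]`-module killed by one Young symmetrizer of each shape is zero. -/
theorem eq_zero_of_youngSymmetrizer_smul_eq_zero {M : Type*} [AddCommGroup M] [Module (QS n) M]
    (h : ∀ μ : YoungDiagram, μ.card = n →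
      ∃ T : Fin n ≃ μ.cells, ∀ v : M, youngSymmetrizer T • v = 0) (v : M) : v = 0 := by
  choose T hT using fun π : (Fintype.card (Fin n)).Partition =>
    h (partitionDiagram π) ((card_partitionDiagram π).trans (Fintype.card_fin n))
  obtain ⟨a, ha⟩ := exists_sum_centralYoung_eq_one T
  rw [← one_smul (QS n) v, ← ha, sum_smul]
  refine sum_eq_zero fun π _ => ?_
  rw [centralYoung, smul_sum, sum_smul]
  refine sum_eq_zero fun g _ => ?_
  rw [← mul_smul_comm, mul_smul, mul_smul, hT, smul_zero]

end Completeness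

/-! ### The inclusion of `S_n` in `S_{n+1}` and tableaux with one added box. -/

section Inclusion

open Finset MonoidAlgebra

theorem permIncl_castSucc {n : ℕ} (g : Equiv.Perm (Fin n)) (i : Fin n) :
    permIncl n g i.castSucc = (g i).castSucc :=
  Equiv.Perm.viaEmbedding_apply g Fin.castSuccEmb i

theorem permIncl_last {n : ℕ} (g : Equiv.Perm (Fin n)) :
    permIncl n g (Fin.last n) = Fin.last n :=
  Equiv.Perm.viaEmbedding_apply_of_notMem g Fin.castSuccEmb _ (by
    rintro ⟨i, hi⟩
    exact (Fin.castSucc_lt_last i).ne hi)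

theorem sign_permIncl {n : ℕ} (g : Equiv.Perm (Fin n)) :
    Equiv.Perm.sign (permIncl n g) = Equiv.Perm.sign g := by
  classical
  rw [permIncl, Equiv.Perm.viaEmbeddingHom_apply, Equiv.Perm.viaEmbedding,
    ← Equiv.Perm.sign_extendDomain g (Equiv.ofInjective _ Fin.castSuccEmb.injective)]
  congr!

theorem exists_permIncl_eq {n : ℕ} (g : Equiv.Perm (Fin (n + 1)))
    (hg : g (Fin.last n) = Fin.last n) :
    ∃ h, permIncl n h = g := by
  have hne : ∀ i : Fin n, g i.castSucc ≠ Fin.last n := fun i hi =>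
    (Fin.castSucc_lt_last i).ne (g.injective (hi.trans hg.symm))
  have hinj : Function.Injective fun i : Fin n => (g i.castSucc).castPred (hne i) :=
    fun i j hij => by simpa using hij
  refine ⟨Equiv.ofBijective _ (Finite.injective_iff_bijective.1 hinj), ?_⟩
  ext1 i
  refine Fin.lastCases ?_ (fun i => ?_) i
  · rw [permIncl_last, hg]
  · rw [permIncl_castSucc]
    simp

/-- The inclusion of group algebras `ℚ[S_n] → ℚ[S_{n+1}]`. -/
def algIncl (n : ℕ) : QS n →ₐ[ℚ] QS (n + 1) := mapDomainAlgHom ℚ ℚ (permIncl n)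

theorem algIncl_single {n : ℕ} (g : Equiv.Perm (Fin n)) (q : ℚ) :
    algIncl n (single g q) = single (permIncl n g) q := by
  simp [algIncl]

variable {n : ℕ} {μ ν : YoungDiagram}

/-- `U` is obtained from `T` by adding one box, in a new column. -/
structure ExtendsTableau (T : Fin n ≃ μ.cells) (U : Fin (n + 1) ≃ ν.cells) : Prop where
  castSucc : ∀ i : Fin n, (U i.castSucc).1 = (T i).1
  last : ∀ i : Fin n, (T i).1.2 ≠ (U (Fin.last n)).1.2

variable {T : Fin n ≃ μ.cells} {U : Fin (n + 1) ≃ ν.cells} (h : ExtendsTableau T U)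
include h

/-- The new entry is alone in its column, so every column permutation of `U` fixes it and comes from
a column permutation of `T`. -/
theorem ExtendsTableau.algIncl_colSym : algIncl n (colSym T) = colSym U := by
  rw [colSym, map_sum, colSym]
  simp only [algIncl_single]
  refine sum_bij (fun g _ => permIncl n g) (fun g hg => ?_) (fun g _ g' _ hgg => ?_)
    (fun g hg => ?_) fun g _ => by rw [sign_permIncl]
  · simp only [mem_filter, mem_univ, true_and] at hg ⊢
    refine fun i => Fin.lastCases ?_ (fun i => ?_) i
    · rw [permIncl_last]
    · rw [permIncl_castSucc, h.castSucc, h.castSucc, hg]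
  · exact Equiv.Perm.viaEmbeddingHom_injective _ hgg
  · simp only [mem_filter, mem_univ, true_and] at hg
    have hl : g (Fin.last n) = Fin.last n := by
      have := hg (Fin.last n)
      induction hx : g (Fin.last n) using Fin.lastCases with
      | last => rfl
      | cast i =>
        rw [hx, h.castSucc] at this
        exact (h.last i this).elim
    obtain ⟨k, rfl⟩ := exists_permIncl_eq g hl
    refine ⟨k, ?_, rfl⟩
    simp only [mem_filter, mem_univ, true_and]
    intro i
    have := hg i.castSucc
    rwa [permIncl_castSucc, h.castSucc, h.castSucc] at this

/-- Since the column sums agree, the product has the form `a_U y b_U`. This is the link between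
levels `n` and `n + 1`. -/
theorem ExtendsTableau.exists_mul_mul_algIncl (x : QS (n + 1)) :
    ∃ q : ℚ, youngSymmetrizer U * x * algIncl n (youngSymmetrizer T) = q • youngSymmetrizer U := by
  obtain ⟨q, hq⟩ := exists_rowSym_mul_mul_colSym U (colSym U * x * algIncl n (rowSym T))
  refine ⟨q, ?_⟩
  rw [← hq, youngSymmetrizer_eq, youngSymmetrizer_eq, map_mul, h.algIncl_colSym]
  simp only [mul_assoc]

end Inclusion

/-! ### Padded partitions. -/

section Padding

open Finset

variable {μ : YoungDiagram} {n : ℕ}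

theorem mem_padded (h : μ.card + μ.rowLen 0 ≤ n) (c : ℕ × ℕ) :
    c ∈ padded μ n h ↔ (c.1 = 0 ∧ c.2 < n - μ.card) ∨ (0 < c.1 ∧ (c.1 - 1, c.2) ∈ μ) := by
  obtain ⟨i, j⟩ := c
  rw [← YoungDiagram.mem_cells, padded]
  simp only [mem_union, mem_map, mem_range, YoungDiagram.mem_cells]
  constructor
  · rintro (⟨a, ha, he⟩ | ⟨⟨a, b⟩, hc, he⟩)
    · obtain ⟨rfl, rfl⟩ := Prod.ext_iff.1 he
      exact Or.inl ⟨rfl, ha⟩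
    · obtain ⟨rfl, rfl⟩ := Prod.ext_iff.1 he
      exact Or.inr ⟨Nat.succ_pos _, hc⟩
  · rintro (⟨h1, h2⟩ | ⟨h1, h2⟩)
    · exact Or.inl ⟨j, h2, Prod.ext h1.symm rfl⟩
    · exact Or.inr ⟨_, h2, Prod.ext (Nat.sub_add_cancel h1) rfl⟩

/-- Every tableau of shape `μ[n]` extends to one of shape `μ[n+1]`. -/
theorem exists_extendsTableau (h : μ.card + μ.rowLen 0 ≤ n) (h' : μ.card + μ.rowLen 0 ≤ n + 1)
    (T : Fin n ≃ (padded μ n h).cells) :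
    ∃ U : Fin (n + 1) ≃ (padded μ (n + 1) h').cells, ExtendsTableau T U := by
  -- Lower rows have length at most `μ.rowLen 0`, hence at most `n - μ.card`. So the box added at
  -- the end of the first row opens a new column.
  have hcol : ∀ i, (T i).1.2 < n - μ.card := fun i => by
    rcases (mem_padded h _).1 ((YoungDiagram.mem_cells _).1 (T i).2) with ⟨-, h2⟩ | ⟨-, h2⟩
    · exact h2
    · have h3 := YoungDiagram.mem_iff_lt_rowLen.1 h2
      have h4 := μ.rowLen_anti 0 _ (Nat.zero_le ((T i).1.1 - 1))
      omega
  have hm : (0, n - μ.card) ∈ (padded μ (n + 1) h').cells := by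
    rw [YoungDiagram.mem_cells, mem_padded]
    exact Or.inl ⟨rfl, show n - μ.card < n + 1 - μ.card by omega⟩
  have hle : ∀ i, (T i).1 ∈ (padded μ (n + 1) h').cells := fun i => by
    rw [YoungDiagram.mem_cells, mem_padded]
    rcases (mem_padded h _).1 ((YoungDiagram.mem_cells _).1 (T i).2) with h2 | h2
    · exact Or.inl ⟨h2.1, by omega⟩
    · exact Or.inr h2
  let f : Fin (n + 1) → (padded μ (n + 1) h').cells :=
    Fin.lastCases ⟨(0, n - μ.card), hm⟩ fun i => ⟨(T i).1, hle i⟩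
  have hfl : f (Fin.last n) = ⟨(0, n - μ.card), hm⟩ := Fin.lastCases_last
  have hfc : ∀ i : Fin n, f i.castSucc = ⟨(T i).1, hle i⟩ := fun i => Fin.lastCases_castSucc ..
  have hf : Function.Injective f := by
    intro i j
    refine Fin.lastCases ?_ (fun i => ?_) i <;> refine Fin.lastCases ?_ (fun j => ?_) j
    · simp
    · rw [hfl, hfc]
      intro he
      have := congrArg (fun c => c.1.2) he
      exact ((hcol j).ne this.symm).elim
    · rw [hfl, hfc]
      intro he
      have := congrArg (fun c => c.1.2) he
      exact ((hcol i).ne this).elim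
    · rw [hfc, hfc]
      intro he
      rw [T.injective (Subtype.ext (congrArg (fun c => c.1) he))]
  have hb : Function.Bijective f := (Fintype.bijective_iff_injective_and_card f).2 ⟨hf, by
    rw [Fintype.card_fin, Fintype.card_coe]
    exact (padded_card μ (n + 1) h').symm⟩
  refine ⟨Equiv.ofBijective f hb, fun i => ?_, fun i => ?_⟩
  · rw [Equiv.ofBijective_apply, hfc]
  · rw [Equiv.ofBijective_apply, hfl]
    exact (hcol i).ne

/-- Every Young diagram with `n` boxes is of the form `μ[n]`. -/
theorem exists_padded_eq (ν : YoungDiagram) (hν : ν.card = n) :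
    ∃ (μ : YoungDiagram) (h : μ.card + μ.rowLen 0 ≤ n), padded μ n h = ν := by
  let e : ℕ × ℕ ↪ ℕ × ℕ := ⟨fun c => (c.1 + 1, c.2), fun a b e => by
      obtain ⟨h1, h2⟩ := Prod.ext_iff.1 e
      exact Prod.ext (Nat.succ_injective h1) h2⟩
  -- The diagram `ν` with its first row removed.
  let μ : YoungDiagram :=
    { cells := ν.cells.preimage e e.injective.injOn
      isLowerSet := by
        rintro ⟨i, j⟩ ⟨i', j'⟩ ⟨hi, hj⟩ hc
        simp only [coe_preimage, Set.mem_preimage, mem_coe, YoungDiagram.mem_cells] at hc ⊢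
        exact ν.up_left_mem (Nat.succ_le_succ hi) hj hc }
  have hμ : ∀ i j, (i, j) ∈ μ ↔ (i + 1, j) ∈ ν := fun i j => by
    rw [← YoungDiagram.mem_cells, mem_preimage, YoungDiagram.mem_cells]
    rfl
  have hrow : μ.rowLen 0 ≤ ν.rowLen 0 := by
    by_contra! hlt
    have h1 := (hμ 0 (ν.rowLen 0)).1 (YoungDiagram.mem_iff_lt_rowLen.2 hlt)
    have h2 := YoungDiagram.mem_iff_lt_rowLen.1 (ν.up_left_mem (Nat.zero_le _) le_rfl h1)
    exact lt_irrefl _ h2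
  have hcard : μ.card + ν.rowLen 0 = n := by
    rw [← hν, YoungDiagram.card, YoungDiagram.card, ← card_map e, YoungDiagram.rowLen_eq_card,
      ← card_union_of_disjoint]
    · congr 1
      ext ⟨i, j⟩
      simp only [mem_union, mem_map, YoungDiagram.mem_row_iff, YoungDiagram.mem_cells]
      constructor
      · rintro (⟨⟨a, b⟩, h1, h2⟩ | h1)
        · rw [← h2]
          exact (hμ a b).1 h1
        · exact h1.1
      · intro h1
        rcases i with _ | i
        · exact Or.inr ⟨h1, rfl⟩
        · exact Or.inl ⟨(i, j), (hμ i j).2 h1, rfl⟩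
    · rw [disjoint_left]
      intro c h1 h2
      obtain ⟨d, -, rfl⟩ := mem_map.1 h1
      exact Nat.succ_ne_zero _ (YoungDiagram.mem_row_iff.1 h2).2
  refine ⟨μ, by omega, ?_⟩
  ext ⟨i, j⟩
  rw [YoungDiagram.mem_cells, YoungDiagram.mem_cells, mem_padded]
  rcases i with _ | i
  · have : n - μ.card = ν.rowLen 0 := by omega
    simp [this, YoungDiagram.mem_iff_lt_rowLen]
  · simp [hμ]

end Padding

/-! ### Specht ideals and multiplicity spaces. -/

section Modules

open Finset MonoidAlgebra

variable {n : ℕ} {μ : YoungDiagram}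

/-- The left ideal generated by the Young symmetrizer of a tableau. -/
abbrev spechtIdeal (T : Fin n ≃ μ.cells) : Ideal (QS n) := Ideal.span {youngSymmetrizer T}

variable (T : Fin n ≃ μ.cells) (M : Type*) [AddCommGroup M] [Module ℚ M] [Module (QS n) M]
  [IsScalarTower ℚ (QS n) M]

/-- The image of the Young symmetrizer on a module. -/
def youngRange : Submodule ℚ M := LinearMap.range (Algebra.lsmul ℚ ℚ M (youngSymmetrizer T))

variable {M}

theorem mem_youngRange {v : M} : v ∈ youngRange T M ↔ ∃ w, youngSymmetrizer T • w = v := Iff.rfl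

theorem smul_mem_youngRange (v : M) : youngSymmetrizer T • v ∈ youngRange T M := ⟨v, rfl⟩

theorem exists_smul_eq_of_mem_youngRange :
    ∃ s : ℚ, s ≠ 0 ∧ ∀ v ∈ youngRange T M, youngSymmetrizer T • v = s • v := by
  obtain ⟨s, hs, hss⟩ := exists_youngSymmetrizer_mul_self T
  refine ⟨s, hs, ?_⟩
  rintro _ ⟨w, rfl⟩
  simp only [Algebra.lsmul_coe]
  rw [smul_smul, hss, smul_assoc]

/-- Write `x = x' c`. Each `c y x` is a multiple of `c`; if all these multiples were zero, then `x y
x = x' (c y x)` would vanish for every `y`, forcing `x = 0`. -/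
theorem exists_smul_mul_ne_zero {x : QS n} (hx : x ∈ spechtIdeal T) (h0 : x ≠ 0) :
    ∃ (y : QS n) (q : ℚ), q ≠ 0 ∧ youngSymmetrizer T * y * x = q • youngSymmetrizer T := by
  obtain ⟨x', rfl⟩ := Ideal.mem_span_singleton'.1 hx
  by_contra! hcon
  refine h0 (eq_zero_of_forall_mul_mul_self_eq_zero fun y => ?_)
  obtain ⟨q, hq⟩ := exists_youngSymmetrizer_mul_mul T (y * x')
  have hq' : youngSymmetrizer T * y * (x' * youngSymmetrizer T) = q • youngSymmetrizer T := by
    rw [← hq]; simp only [mul_assoc]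
  by_cases h : q = 0
  · calc _ = x' * (youngSymmetrizer T * y * (x' * youngSymmetrizer T)) := by simp only [mul_assoc]
      _ = 0 := by rw [hq', h, zero_smul, mul_zero]
  · exact (hcon y q h hq').elim

/-- Any nonzero element of the ideal can be multiplied on the left back to the generator. -/
instance isSimpleModule_spechtIdeal : IsSimpleModule (QS n) (spechtIdeal T) := by
  have hc : youngSymmetrizer T ∈ spechtIdeal T := Ideal.mem_span_singleton_self _
  rw [isSimpleModule_iff_toSpanSingleton_surjective]
  refine ⟨⟨⟨⟨_, hc⟩, 0, fun h => ?_⟩⟩, ?_⟩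
  · have h1 := coeff_youngSymmetrizer_one T
    rw [show youngSymmetrizer T = 0 from Subtype.ext_iff.1 h] at h1
    exact zero_ne_one h1
  · rintro ⟨x, hx⟩ h0 ⟨z, hz⟩
    obtain ⟨y, q, hq, hyq⟩ := exists_smul_mul_ne_zero T hx fun h => h0 (Subtype.ext h)
    obtain ⟨z', rfl⟩ := Ideal.mem_span_singleton'.1 hz
    refine ⟨q⁻¹ • (z' * (youngSymmetrizer T * y)), Subtype.ext ?_⟩
    change q⁻¹ • (z' * (youngSymmetrizer T * y)) * x = z' * youngSymmetrizer T
    rw [smul_mul_assoc, mul_assoc, hyq, mul_smul_comm, inv_smul_smul₀ hq]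

/-- The linear map from a power of the Specht ideal determined by a tuple of vectors. -/
def spechtLift {k : ℕ} (v : Fin k → M) : (Fin k → spechtIdeal T) →ₗ[QS n] M :=
  ∑ i, LinearMap.toSpanSingleton (QS n) M (v i) ∘ₗ (spechtIdeal T).subtype ∘ₗ LinearMap.proj i

omit [Module ℚ M] [IsScalarTower ℚ (QS n) M] in
theorem spechtLift_apply {k : ℕ} (v : Fin k → M) (x : Fin k → spechtIdeal T) :
    spechtLift T v x = ∑ i, (x i : QS n) • v i := by
  simp [spechtLift]

/-- Multiplying a relation `∑ x_i v_i = 0` by `c y` turns every coefficient into a rational multiple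
of `c`, which acts on the `v_i` by the scalar `s`. The result is a rational relation, and `y` is
chosen to keep one coefficient nonzero. -/
theorem spechtLift_injective {k : ℕ} {v : Fin k → M} (hv : LinearIndependent ℚ v)
    (hr : ∀ i, v i ∈ youngRange T M) : Function.Injective (spechtLift T v) := by
  obtain ⟨s, hs, hss⟩ := exists_smul_eq_of_mem_youngRange (M := M) T
  rw [injective_iff_map_eq_zero]
  intro x hx
  by_contra hne
  obtain ⟨i₀, hi⟩ := Function.ne_iff.1 hne
  obtain ⟨y, q₀, hq₀, hyq⟩ := exists_smul_mul_ne_zero T (x i₀).2 fun h => hi (Subtype.ext h)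
  have key : ∀ i, ∃ q : ℚ, youngSymmetrizer T * y * (x i : QS n) = q • youngSymmetrizer T := by
    intro i
    obtain ⟨x', hx'⟩ := Ideal.mem_span_singleton'.1 (x i).2
    obtain ⟨q, hq⟩ := exists_youngSymmetrizer_mul_mul T (y * x')
    exact ⟨q, by rw [← hq, ← hx']; simp only [mul_assoc]⟩
  choose q hq using key
  have h1 := congrArg ((youngSymmetrizer T * y) • ·) hx
  simp only [spechtLift_apply, smul_sum, smul_zero, smul_smul, hq, smul_assoc,
    hss _ (hr _)] at h1
  have h2 := Fintype.linearIndependent_iff.1 hv q ((smul_eq_zero.1 (show s • ∑ i, q i • v i = 0 by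
    rw [smul_sum, ← h1]
    exact sum_congr rfl fun i _ => by rw [smul_smul, mul_comm])).resolve_left hs) i₀
  have h3 := hyq.symm.trans (hq i₀)
  rw [h2, zero_smul] at h3
  rcases smul_eq_zero.1 h3 with h4 | h4
  · exact hq₀ h4
  · have h5 := coeff_youngSymmetrizer_one T
    rw [h4] at h5
    exact zero_ne_one h5

/-- With `exists_linearIndependent_of_equiv`, this trades `k` copies of an irreducible for `k`
independent vectors in the image of the symmetrizer. -/
theorem exists_submodule_equiv_of_linearIndependent {k : ℕ} {v : Fin k → M}
    (hv : LinearIndependent ℚ v) (hr : ∀ i, v i ∈ youngRange T M) (Z : Submodule (QS n) M)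
    (hZ : ∀ i, v i ∈ Z) :
    ∃ W ≤ Z, Nonempty (W ≃ₗ[QS n] (Fin k → spechtIdeal T)) := by
  refine ⟨LinearMap.range (spechtLift T v), ?_,
    ⟨(LinearEquiv.ofInjective _ (spechtLift_injective T hv hr)).symm⟩⟩
  rintro _ ⟨x, rfl⟩
  rw [spechtLift_apply]
  exact Submodule.sum_mem _ fun i _ => Z.smul_mem _ (hZ i)

/-- The vectors correspond to the generator `c` placed in each coordinate. As `c = c (s⁻¹ c)`, they
lie in the image of `c`. -/
theorem exists_linearIndependent_of_equiv {k : ℕ} {W : Submodule (QS n) M}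
    (e : W ≃ₗ[QS n] (Fin k → spechtIdeal T)) :
    ∃ v : Fin k → M, LinearIndependent ℚ v ∧ (∀ i, v i ∈ W) ∧ ∀ i, v i ∈ youngRange T M := by
  obtain ⟨s, hs, hss⟩ := exists_youngSymmetrizer_mul_self T
  let c : spechtIdeal T := ⟨_, Ideal.mem_span_singleton_self _⟩
  let u : Fin k → Fin k → spechtIdeal T := fun i => Pi.single i c
  have hc : c ≠ 0 := fun h => by
    have h1 := coeff_youngSymmetrizer_one T
    rw [show youngSymmetrizer T = 0 from Subtype.ext_iff.1 h] at h1
    exact zero_ne_one h1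
  have hcc : youngSymmetrizer T • c = (s • (1 : QS n)) • c := Subtype.ext (by
    change youngSymmetrizer T * youngSymmetrizer T = (s • (1 : QS n)) * youngSymmetrizer T
    rw [hss, smul_mul_assoc, one_mul])
  have huc : ∀ i, u i = youngSymmetrizer T • (s⁻¹ • (1 : QS n)) • u i := fun i => by
    simp only [u]
    rw [← Pi.single_smul, ← Pi.single_smul]
    congr 1
    refine Subtype.ext ?_
    change youngSymmetrizer T = youngSymmetrizer T * ((s⁻¹ • (1 : QS n)) * youngSymmetrizer T)
    rw [smul_mul_assoc, one_mul, mul_smul_comm, hss, inv_smul_smul₀ hs]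
  refine ⟨fun i => e.symm (u i), ?_, fun i => (e.symm (u i)).2, fun i => ?_⟩
  · rw [Fintype.linearIndependent_iff]
    intro q hq i
    have h1 : e.symm (∑ i, (q i • (1 : QS n)) • u i) = 0 := by
      refine Subtype.ext (Eq.trans ?_ hq)
      rw [map_sum, AddSubmonoidClass.coe_finsetSum]
      refine sum_congr rfl fun i _ => ?_
      rw [map_smul, Submodule.coe_smul, smul_assoc, one_smul]
    have h2 := congrFun ((LinearEquiv.map_eq_zero_iff _).1 h1) i
    rw [Finset.sum_apply, sum_eq_single i (fun j _ hj => by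
        simp only [u, Pi.smul_apply]
        rw [Pi.single_eq_of_ne hj.symm, smul_zero])
      (fun h => (h (mem_univ _)).elim)] at h2
    simp only [u, Pi.smul_apply, Pi.single_eq_same] at h2
    have h3 : q i • youngSymmetrizer T = 0 := by
      have := Subtype.ext_iff.1 h2
      change (q i • (1 : QS n)) * youngSymmetrizer T = 0 at this
      rwa [smul_mul_assoc, one_mul] at this
    exact (smul_eq_zero.1 h3).resolve_right fun h => hc (Subtype.ext h)
  · refine ⟨(e.symm ((s⁻¹ • (1 : QS n)) • u i) : W), ?_⟩
    change youngSymmetrizer T • ((e.symm _ : W) : M) = _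
    rw [← Submodule.coe_smul, ← map_smul, ← huc]

/-- The isotypic component of the irreducible representation of a tableau is a power of it, with
exponent the rank of the Young symmetrizer. -/
theorem length_isotypicComponent [FiniteDimensional ℚ M] :
    Module.length (QS n) (isotypicComponent (QS n) M (spechtIdeal T)) =
      Module.finrank ℚ (youngRange T M) := by
  obtain ⟨s, hs, hss⟩ := exists_youngSymmetrizer_mul_self T
  let b := Module.finBasis ℚ (youngRange T M)
  let v : Fin (Module.finrank ℚ (youngRange T M)) → M := fun i => b i
  have hv : LinearIndependent ℚ v :=
    b.linearIndependent.map' (youngRange T M).subtype (Submodule.ker_subtype _)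
  have heq : isotypicComponent (QS n) M (spechtIdeal T) = LinearMap.range (spechtLift T v) := by
    refine le_antisymm (sSup_le ?_) ?_
    · rintro N ⟨e⟩ x hx
      let c : spechtIdeal T := ⟨_, Ideal.mem_span_singleton_self _⟩
      have hcc : youngSymmetrizer T • (s⁻¹ • (1 : QS n)) • c = c := Subtype.ext (by
        change youngSymmetrizer T * ((s⁻¹ • (1 : QS n)) * youngSymmetrizer T) = youngSymmetrizer T
        rw [smul_mul_assoc, one_mul, mul_smul_comm, hss, inv_smul_smul₀ hs])
      have hr : ((e.symm c : N) : M) ∈ youngRange T M := by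
        refine ⟨(e.symm ((s⁻¹ • (1 : QS n)) • c) : N), ?_⟩
        change youngSymmetrizer T • ((e.symm _ : N) : M) = _
        rw [← Submodule.coe_smul, ← map_smul, hcc]
      -- The image of the generator lies in `c M`, so it expands in the basis. The factor `s⁻¹`
      -- compensates for `c` acting there by `s`.
      have hmem : ((e.symm c : N) : M) ∈ LinearMap.range (spechtLift T v) := by
        refine ⟨fun i => (s⁻¹ • b.repr ⟨_, hr⟩ i) • c, ?_⟩
        have h1 := congrArg Subtype.val (b.sum_repr ⟨_, hr⟩)
        simp only [AddSubmonoidClass.coe_finsetSum, Submodule.coe_smul] at h1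
        rw [spechtLift_apply]
        refine Eq.trans (sum_congr rfl fun i _ => ?_) h1
        have h2 : youngSymmetrizer T • v i = s • v i := by
          obtain ⟨w, hw⟩ := (b i).2
          change youngSymmetrizer T • ((b i : youngRange T M) : M) =
            s • ((b i : youngRange T M) : M)
          rw [← hw, Algebra.lsmul_coe, smul_smul, hss, smul_assoc]
        change ((s⁻¹ • b.repr ⟨_, hr⟩ i) • youngSymmetrizer T) • v i = _
        rw [smul_assoc, h2, smul_eq_mul, mul_comm, mul_smul, inv_smul_smul₀ hs]
      obtain ⟨z, hz⟩ := Ideal.mem_span_singleton'.1 (e ⟨x, hx⟩).2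
      have hx' : x = z • ((e.symm c : N) : M) := by
        rw [← Submodule.coe_smul, ← map_smul, show z • c = e ⟨x, hx⟩ from Subtype.ext hz,
          e.symm_apply_apply]
      rw [hx']
      exact Submodule.smul_mem _ _ hmem
    · rintro _ ⟨x, rfl⟩
      rw [spechtLift_apply]
      refine Submodule.sum_mem _ fun i _ => ?_
      exact Submodule.map_le_isotypicComponent (spechtIdeal T)
        (LinearMap.toSpanSingleton (QS n) M (v i)) ⟨x i, (x i).2, rfl⟩
  rw [heq, ← (LinearEquiv.ofInjective _ (spechtLift_injective T hv fun i => (b i).2)).length_eq,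
    Module.length_pi]
  simp

/-- The irreducible representations of two tableaux of the same shape are isomorphic. -/
theorem nonempty_spechtIdeal_equiv (T T' : Fin n ≃ μ.cells) :
    Nonempty (spechtIdeal T ≃ₗ[QS n] spechtIdeal T') := by
  let g : Equiv.Perm (Fin n) := T.trans T'.symm
  have hT : T = (g⁻¹)⁻¹.trans T' := by
    refine Equiv.ext fun i => ?_
    rw [inv_inv]
    simp [g]
  have h1 : ∀ y : QS n, y * single g⁻¹ 1 * single g 1 = y := fun y => by
    rw [mul_assoc, single_mul_single, inv_mul_cancel, one_mul, ← one_def, mul_one]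
  have h2 : ∀ y : QS n, y * single g 1 * single g⁻¹ 1 = y := fun y => by
    rw [mul_assoc, single_mul_single, mul_inv_cancel, one_mul, ← one_def, mul_one]
  -- Right multiplication by `g⁻¹`, where `g` relabels `T` into `T'`; here `c_T g⁻¹ = g⁻¹ c_{T'}`.
  let e : QS n ≃ₗ[QS n] QS n := LinearEquiv.ofLinearMap
    (LinearMap.toSpanSingleton (QS n) (QS n) (single g⁻¹ 1))
    (LinearMap.toSpanSingleton (QS n) (QS n) (single g 1))
    (LinearMap.ext fun y => h2 y) (LinearMap.ext fun y => h1 y)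
  have he : Submodule.map e.toLinearMap (spechtIdeal T) = spechtIdeal T' := by
    have hc : e (youngSymmetrizer T) = single g⁻¹ 1 * youngSymmetrizer T' := by
      rw [single_mul_youngSymmetrizer, ← hT]
      rfl
    rw [spechtIdeal, Ideal.span, Submodule.map_span, Set.image_singleton]
    refine le_antisymm (Submodule.span_le.2 ?_) (Submodule.span_le.2 ?_)
    · rw [Set.singleton_subset_iff]
      refine (congrArg (· ∈ spechtIdeal T') hc).mpr ?_
      exact Ideal.mul_mem_left _ _ (Ideal.mem_span_singleton_self _)
    · rw [Set.singleton_subset_iff]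
      refine Submodule.mem_span_singleton.2 ⟨single g 1, ?_⟩
      refine (congrArg (single g (1 : ℚ) • ·) hc).trans ?_
      change single g 1 * (single g⁻¹ 1 * youngSymmetrizer T') = youngSymmetrizer T'
      rw [← mul_assoc, single_mul_single, mul_inv_cancel, one_mul, ← one_def, one_mul]
  exact ⟨(e.submoduleMap (spechtIdeal T)).trans (LinearEquiv.ofEq _ _ he)⟩

end Modules

/-! ### Stability of a consistent sequence in terms of Young symmetrizers. -/

namespace ConsistentSeq

open Finset MonoidAlgebra

variable (Y : ConsistentSeq) {n : ℕ}

/-- `φMod` as a `ℚ`-linear map. -/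
def φLin (n : ℕ) : Y.mod n →ₗ[ℚ] Y.mod (n + 1) :=
  (Y.ρ (n + 1)).asModuleEquiv.symm.toLinearMap ∘ₗ Y.φ n ∘ₗ (Y.ρ n).asModuleEquiv.toLinearMap

theorem φLin_apply (v : Y.mod n) : Y.φLin n v = Y.φMod n v := rfl

theorem φLin_smul (x : QS n) (v : Y.mod n) : Y.φLin n (x • v) = algIncl n x • Y.φLin n v := by
  have key : ∀ g : Equiv.Perm (Fin n), Y.φLin n (single g (1 : ℚ) • v) =
      algIncl n (single g 1) • Y.φLin n v := fun g => by
    rw [algIncl_single, Representation.single_smul, Representation.single_smul, one_smul, one_smul]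
    exact Y.φ_equivariant n g v
  rw [eq_sum_smul_single x]
  simp only [sum_smul, map_sum, smul_assoc, map_smul, key]

theorem φLin_injective_iff : Function.Injective (Y.φLin n) ↔ Function.Injective (Y.φ n) := Iff.rfl

instance [FiniteDimensional ℚ (Y.V n)] : FiniteDimensional ℚ (Y.mod n) :=
  Module.Finite.equiv (Y.ρ n).asModuleEquiv.symm

/-- The multiplicity of `V(μ)_n` is the rank of any Young symmetrizer of shape `μ[n]`. -/
theorem mult_eq_finrank [FiniteDimensional ℚ (Y.V n)] (μ : YoungDiagram)
    (h : μ.card + μ.rowLen 0 ≤ n) (T : Fin n ≃ (padded μ n h).cells) :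
    Y.mult μ n = Module.finrank ℚ (youngRange T (Y.mod n)) := by
  rw [mult, dif_pos h, ← length_isotypicComponent]
  obtain ⟨e⟩ := nonempty_spechtIdeal_equiv (Finset.equivFinOfCardEq (padded_card μ n h)).symm T
  exact congrArg (fun W : Submodule (QS n) (Y.mod n) => Module.length (QS n) W)
    e.isotypicComponent_eq

/-- A tableau of shape `μ[n]`. -/
def paddedTableau (μ : YoungDiagram) (n : ℕ) (h : μ.card + μ.rowLen 0 ≤ n) :
    Fin n ≃ (padded μ n h).cells :=
  (Finset.equivFinOfCardEq (padded_card μ n h)).symm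

/-- The map `φ n` identifies the multiplicity spaces of `V(μ)_n` in `V n` and of `V(μ)_{n+1}` in
`V (n + 1)`. -/
structure YoungStable (n : ℕ) : Prop where
  eq_zero : ∀ (μ : YoungDiagram) (h : μ.card + μ.rowLen 0 ≤ n) (h' : μ.card + μ.rowLen 0 ≤ n + 1)
    (T : Fin n ≃ (padded μ n h).cells) (U : Fin (n + 1) ≃ (padded μ (n + 1) h').cells),
    ExtendsTableau T U → ∀ v ∈ youngRange T (Y.mod n),
      youngSymmetrizer U • Y.φLin n v = 0 → v = 0
  exists_eq : ∀ (μ : YoungDiagram) (h : μ.card + μ.rowLen 0 ≤ n)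
    (h' : μ.card + μ.rowLen 0 ≤ n + 1)
    (T : Fin n ≃ (padded μ n h).cells) (U : Fin (n + 1) ≃ (padded μ (n + 1) h').cells),
    ExtendsTableau T U → ∀ w ∈ youngRange U (Y.mod (n + 1)),
      ∃ v ∈ youngRange T (Y.mod n), youngSymmetrizer U • Y.φLin n v = w
  smul_eq_zero : ∀ (μ : YoungDiagram), ¬ μ.card + μ.rowLen 0 ≤ n →
    ∀ (h' : μ.card + μ.rowLen 0 ≤ n + 1) (U : Fin (n + 1) ≃ (padded μ (n + 1) h').cells)
      (w : Y.mod (n + 1)), youngSymmetrizer U • w = 0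

namespace YoungStable

variable {Y} (hY : Y.YoungStable n)
include hY

/-- The kernel is a submodule. A vector `c_T w` of it has `c_U φ(c_T w) = 0`, so it vanishes; every
shape with `n` boxes is some `μ[n]`, and completeness applies. -/
theorem injective : Function.Injective (Y.φ n) := by
  rw [← φLin_injective_iff, injective_iff_map_eq_zero]
  let K : Submodule (QS n) (Y.mod n) :=
    { carrier := {v | Y.φLin n v = 0}
      add_mem' := fun {a b} ha hb => by
        rw [Set.mem_ofPred_eq] at *
        rw [map_add, ha, hb, add_zero]
      zero_mem' := map_zero _
      smul_mem' := fun x v hv => by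
        rw [Set.mem_ofPred_eq] at *
        rw [φLin_smul, hv, smul_zero] }
  intro v hv
  refine congrArg Subtype.val (eq_zero_of_youngSymmetrizer_smul_eq_zero (n := n) (M := K)
    (fun ν hν => ?_) ⟨v, hv⟩)
  obtain ⟨μ, h, rfl⟩ := exists_padded_eq ν hν
  refine ⟨paddedTableau μ n h, fun w => Subtype.ext ?_⟩
  obtain ⟨U, hU⟩ := exists_extendsTableau h (Nat.le_succ_of_le h) (paddedTableau μ n h)
  refine hY.eq_zero μ h _ _ U hU _ (smul_mem_youngRange _ _) ?_
  have : Y.φLin n (youngSymmetrizer (paddedTableau μ n h) • (w : Y.mod n)) = 0 :=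
    (youngSymmetrizer (paddedTableau μ n h) • w).2
  exact (congrArg (youngSymmetrizer U • ·) this).trans (smul_zero _)

/-- Completeness is applied to the cokernel: `c_U z` equals some `c_U φ(v)`, which lies in the span,
and shapes new at `n + 1` are killed outright. -/
theorem spanImage_top : Y.spanImage n ⊤ = ⊤ := by
  rw [eq_top_iff]
  intro w _
  rw [← Submodule.Quotient.mk_eq_zero]
  refine eq_zero_of_youngSymmetrizer_smul_eq_zero (n := n + 1) (fun ν hν => ?_) _
  obtain ⟨μ, h', rfl⟩ := exists_padded_eq ν hν
  by_cases h : μ.card + μ.rowLen 0 ≤ n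
  · obtain ⟨U, hU⟩ := exists_extendsTableau h h' (paddedTableau μ n h)
    refine ⟨U, fun z => ?_⟩
    obtain ⟨z, rfl⟩ := Submodule.Quotient.mk_surjective _ z
    obtain ⟨v, -, hv⟩ := hY.exists_eq μ h h' _ U hU _ (smul_mem_youngRange U z)
    rw [← Submodule.Quotient.mk_smul, Submodule.Quotient.mk_eq_zero, ← hv]
    exact Submodule.smul_mem _ _ (Submodule.subset_span ⟨v, trivial, rfl⟩)
  · refine ⟨paddedTableau μ (n + 1) h', fun z => ?_⟩
    obtain ⟨z, rfl⟩ := Submodule.Quotient.mk_surjective _ z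
    rw [← Submodule.Quotient.mk_smul, hY.smul_eq_zero μ h h']
    rfl

theorem mult_eq [FiniteDimensional ℚ (Y.V n)] [FiniteDimensional ℚ (Y.V (n + 1))]
    (μ : YoungDiagram) : Y.mult μ n = Y.mult μ (n + 1) := by
  by_cases h : μ.card + μ.rowLen 0 ≤ n
  · have h' := Nat.le_succ_of_le h
    obtain ⟨U, hU⟩ := exists_extendsTableau h h' (paddedTableau μ n h)
    rw [mult_eq_finrank Y μ h (paddedTableau μ n h), mult_eq_finrank Y μ h' U]
    let f : youngRange (paddedTableau μ n h) (Y.mod n) →ₗ[ℚ] Y.mod (n + 1) :=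
      (Algebra.lsmul ℚ ℚ _ (youngSymmetrizer U) ∘ₗ Y.φLin n) ∘ₗ Submodule.subtype _
    have hf : Function.Injective f := (injective_iff_map_eq_zero f).2 fun v hv =>
      Subtype.ext (hY.eq_zero μ h h' _ U hU v v.2 hv)
    have hr : LinearMap.range f = youngRange U (Y.mod (n + 1)) := by
      refine le_antisymm ?_ fun w hw => ?_
      · rintro _ ⟨v, rfl⟩
        exact smul_mem_youngRange U _
      · obtain ⟨v, hv, hvw⟩ := hY.exists_eq μ h h' _ U hU w hw
        exact ⟨⟨v, hv⟩, hvw⟩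
    rw [← hr, LinearMap.finrank_range_of_inj hf]
  · by_cases h' : μ.card + μ.rowLen 0 ≤ n + 1
    · rw [mult_eq_finrank Y μ h' (paddedTableau μ (n + 1) h'), mult, dif_neg h]
      have : youngRange (paddedTableau μ (n + 1) h') (Y.mod (n + 1)) = ⊥ := by
        rw [eq_bot_iff]
        rintro _ ⟨w, rfl⟩
        exact hY.smul_eq_zero μ h h' _ w
      rw [this, finrank_bot, Nat.cast_zero]
    · rw [mult, mult, dif_neg h, dif_neg h']

/-- Independent vectors of `W` in `c_T V_n` stay independent under `c_U φ`, and their images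
generate the required copies inside the span. -/
theorem exists_le_spanImage (μ : YoungDiagram) (h : μ.card + μ.rowLen 0 ≤ n)
    (h' : μ.card + μ.rowLen 0 ≤ n + 1) (k : ℕ) (W : Submodule (QS n) (Y.mod n))
    (hW : Nonempty (W ≃ₗ[QS n] (Fin k → paddedIrrep μ n h))) :
    ∃ W' : Submodule (QS (n + 1)) (Y.mod (n + 1)), W' ≤ Y.spanImage n W ∧
      Nonempty (W' ≃ₗ[QS (n + 1)] (Fin k → paddedIrrep μ (n + 1) h')) := by
  obtain ⟨e⟩ := hW
  obtain ⟨U, hU⟩ := exists_extendsTableau h h' (paddedTableau μ n h)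
  obtain ⟨v, hv, hvW, hvr⟩ := exists_linearIndependent_of_equiv (paddedTableau μ n h) e
  have hlin : LinearIndependent ℚ fun i => youngSymmetrizer U • Y.φLin n (v i) := by
    rw [Fintype.linearIndependent_iff] at hv ⊢
    intro q hq
    refine hv q (hY.eq_zero μ h h' _ U hU _
      (Submodule.sum_mem _ fun i _ => Submodule.smul_mem _ _ (hvr i)) ?_)
    rw [← hq, map_sum, smul_sum]
    refine sum_congr rfl fun i _ => ?_
    rw [map_smul, smul_comm]
  obtain ⟨W', hW', ⟨e'⟩⟩ := exists_submodule_equiv_of_linearIndependent U hlin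
    (fun i => smul_mem_youngRange U _) (Y.spanImage n W)
    fun i => Submodule.smul_mem _ _ (Submodule.subset_span ⟨v i, hvW i, rfl⟩)
  obtain ⟨e₂⟩ := nonempty_spechtIdeal_equiv U (paddedTableau μ (n + 1) h')
  exact ⟨W', hW', ⟨e'.trans (LinearEquiv.piCongrRight fun _ => e₂)⟩⟩

end YoungStable

theorem monotone_of_youngStable {N : ℕ} (h : ∀ n, 1 ≤ n → N ≤ n → Y.YoungStable n) :
    Y.Monotone N where
  injective n h1 hN := (h n h1 hN).injective
  span_contains n h1 hN μ hμ k W hW := (h n h1 hN).exists_le_spanImage μ hμ _ k W hW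

theorem uniformlyRepStable_of_youngStable {N : ℕ} (hfd : ∀ n, 1 ≤ n → FiniteDimensional ℚ (Y.V n))
    (h : ∀ n, 1 ≤ n → N ≤ n → Y.YoungStable n) : Y.UniformlyRepStable N where
  finiteDimensional := hfd
  injective n h1 hN := (h n h1 hN).injective
  surjective n h1 hN := (h n h1 hN).spanImage_top
  mult_stable μ m n hm1 hmN hn1 hnN := by
    have key : ∀ m n, 1 ≤ m → N ≤ m → m ≤ n → Y.mult μ m = Y.mult μ n := by
      intro m n hm hmN hmn
      induction n, hmn using Nat.le_induction with
      | base => rfl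
      | succ n hmn ih =>
        have := hfd n (hm.trans hmn)
        have := hfd (n + 1) (Nat.le_add_left 1 n)
        exact ih.trans ((h n (hm.trans hmn) (hmN.trans hmn)).mult_eq μ)
    rcases le_total m n with hmn | hmn
    · exact key m n hm1 hmN hmn
    · exact (key n m hn1 hnN hmn).symm

/-- Monotone uniformly stable sequences have stable multiplicity spaces. -/
theorem youngStable_of_monotone {N : ℕ} (hmono : Y.Monotone N) (hstab : Y.UniformlyRepStable N)
    (h1 : 1 ≤ n) (hN : N ≤ n) : Y.YoungStable n := by
  have := hstab.finiteDimensional n h1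
  have := hstab.finiteDimensional (n + 1) (Nat.le_add_left 1 n)
  have hmult : ∀ μ, Y.mult μ n = Y.mult μ (n + 1) := fun μ =>
    hstab.mult_stable μ n (n + 1) h1 hN (Nat.le_add_left 1 n) (Nat.le_succ_of_le hN)
  have hrank : ∀ (μ : YoungDiagram) (h : μ.card + μ.rowLen 0 ≤ n)
      (h' : μ.card + μ.rowLen 0 ≤ n + 1) (T : Fin n ≃ (padded μ n h).cells)
      (U : Fin (n + 1) ≃ (padded μ (n + 1) h').cells),
      Module.finrank ℚ (youngRange T (Y.mod n)) =
        Module.finrank ℚ (youngRange U (Y.mod (n + 1))) := fun μ h h' T U => by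
    have := hmult μ
    rw [mult_eq_finrank Y μ h T, mult_eq_finrank Y μ h' U] at this
    exact_mod_cast this
  have hsurj : ∀ (μ : YoungDiagram) (h : μ.card + μ.rowLen 0 ≤ n)
      (h' : μ.card + μ.rowLen 0 ≤ n + 1) (T : Fin n ≃ (padded μ n h).cells)
      (U : Fin (n + 1) ≃ (padded μ (n + 1) h').cells), ExtendsTableau T U →
      ∀ w ∈ youngRange U (Y.mod (n + 1)),
        ∃ v ∈ youngRange T (Y.mod n), youngSymmetrizer U • Y.φLin n v = w := by
    intro μ h h' T U hTU
    obtain ⟨s, hs, hss⟩ := exists_smul_eq_of_mem_youngRange (M := Y.mod (n + 1)) U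
    let k := Module.finrank ℚ (youngRange T (Y.mod n))
    let b := Module.finBasis ℚ (youngRange T (Y.mod n))
    let v : Fin k → Y.mod n := fun i => b i
    have hv : LinearIndependent ℚ v :=
      b.linearIndependent.map' (youngRange T _).subtype (Submodule.ker_subtype _)
    let W := LinearMap.range (spechtLift T v)
    have eW : W ≃ₗ[QS n] (Fin k → spechtIdeal T) :=
      (LinearEquiv.ofInjective _ (spechtLift_injective T hv fun i => (b i).2)).symm
    obtain ⟨e₁⟩ := nonempty_spechtIdeal_equiv T (paddedTableau μ n h)
    obtain ⟨e₂⟩ := nonempty_spechtIdeal_equiv (paddedTableau μ (n + 1) h') U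
    -- Monotonicity is used for the submodule `W` generated by all of `c_T V_n`, so that `k` is the
    -- full multiplicity.
    obtain ⟨W', hW', ⟨eW'⟩⟩ := hmono.span_contains n h1 hN μ h k W
      ⟨eW.trans (LinearEquiv.piCongrRight fun _ => e₁)⟩
    obtain ⟨w, hw, hwW, hwr⟩ := exists_linearIndependent_of_equiv U
      (eW'.trans (LinearEquiv.piCongrRight fun _ => e₂))
    let f : Y.mod n →ₗ[ℚ] Y.mod (n + 1) := Algebra.lsmul ℚ ℚ _ (youngSymmetrizer U) ∘ₗ Y.φLin n
    let R := (youngRange T (Y.mod n)).map f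
    -- Elements of `W` are sums of terms `x' c_T v_i`, and `c_U y x' c_T` is a multiple of `c_U`.
    -- The factor `y` is carried along so that the induction passes through scalar multiplication.
    have hspan : ∀ z ∈ Y.spanImage n W, ∀ y : QS (n + 1), youngSymmetrizer U • y • z ∈ R := by
      intro z hz
      refine Submodule.span_induction ?_ ?_ ?_ ?_ hz
      · rintro _ ⟨_, ⟨x, rfl⟩, rfl⟩ y
        rw [← φLin_apply, spechtLift_apply, map_sum, smul_sum, smul_sum]
        refine Submodule.sum_mem _ fun i _ => ?_
        obtain ⟨x', hx'⟩ := Ideal.mem_span_singleton'.1 (x i).2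
        obtain ⟨q, hq⟩ := hTU.exists_mul_mul_algIncl (y * algIncl n x')
        have h2 : youngSymmetrizer U • y • Y.φLin n ((x i : QS n) • v i) =
            q • youngSymmetrizer U • Y.φLin n (v i) := by
          rw [φLin_smul, ← hx', map_mul, smul_smul, smul_smul, ← smul_assoc q, ← hq]
          simp only [mul_assoc]
        rw [h2]
        exact Submodule.smul_mem _ _ ⟨v i, (b i).2, rfl⟩
      · intro y
        rw [smul_zero, smul_zero]
        exact R.zero_mem
      · intro z z' _ _ hz hz' y
        rw [smul_add, smul_add]
        exact R.add_mem (hz y) (hz' y)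
      · intro y' z _ hz y
        rw [smul_smul y]
        exact hz _
    have hle : youngRange U (Y.mod (n + 1)) ≤ R := by
      -- The copies found at level `n + 1` exhaust the multiplicity space, since stability makes its
      -- dimension equal to `k`.
      have hwspan : Submodule.span ℚ (Set.range w) = youngRange U (Y.mod (n + 1)) := by
        refine Submodule.eq_of_le_of_finrank_eq (Submodule.span_le.2 ?_) ?_
        · rintro _ ⟨i, rfl⟩
          exact hwr i
        · rw [finrank_span_eq_card hw, Fintype.card_fin]
          exact hrank μ h h' T U
      rw [← hwspan, Submodule.span_le]
      rintro _ ⟨i, rfl⟩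
      have h2 := hspan _ (hW' (hwW i)) 1
      rw [one_smul, hss _ (hwr i)] at h2
      have h3 := R.smul_mem s⁻¹ h2
      rwa [inv_smul_smul₀ hs] at h3
    intro w hw
    exact hle hw
  refine ⟨fun μ h h' T U hTU v hv hv0 => ?_, hsurj, fun μ h h' U w => ?_⟩
  · let f : youngRange T (Y.mod n) →ₗ[ℚ] youngRange U (Y.mod (n + 1)) :=
      LinearMap.codRestrict _
        ((Algebra.lsmul ℚ ℚ _ (youngSymmetrizer U) ∘ₗ Y.φLin n) ∘ₗ Submodule.subtype _)
        fun v => smul_mem_youngRange U _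
    have hf : Function.Surjective f := fun w => by
      obtain ⟨v, hv, hvw⟩ := hsurj μ h h' T U hTU w w.2
      exact ⟨⟨v, hv⟩, Subtype.ext hvw⟩
    have hinj := (LinearMap.injective_iff_surjective_of_finrank_eq_finrank
      (hrank μ h h' T U)).2 hf
    exact congrArg Subtype.val ((injective_iff_map_eq_zero f).1 hinj ⟨v, hv⟩ (Subtype.ext hv0))
  · have h2 := hmult μ
    rw [mult_eq_finrank Y μ h' U, mult, dif_neg h] at h2
    have h3 : Module.finrank ℚ (youngRange U (Y.mod (n + 1))) = 0 := by exact_mod_cast h2.symm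
    rw [Submodule.finrank_eq_zero] at h3
    have h4 := smul_mem_youngRange U w
    rwa [h3, Submodule.mem_bot] at h4

end ConsistentSeq

open CategoryTheory TensorProduct

/-! ### Rationalization of `ℤ[G]`-modules. -/

section Rationalization

variable {G : Type} [Group G]

/-- The action of `G` on the rationalization `ℚ ⊗ P` of a `ℤ[G]`-module. -/
def ratAction (P : Type) [AddCommGroup P] [Module ℤ[G] P] : Representation ℚ G (ℚ ⊗[ℤ] P) :=
  (Module.End.baseChangeHom ℤ ℚ P : _ →* _).comp (Representation.ofModule' (k := ℤ) (G := G) P)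

/-- The rationalization `ℚ ⊗ P` of a `ℤ[G]`-module, as a rational representation. -/
abbrev ratRep (P : Type) [AddCommGroup P] [Module ℤ[G] P] : Rep.{0} ℚ G :=
  Rep.of (ratAction (G := G) P)

variable {P Q : Type} [AddCommGroup P] [Module ℤ[G] P] [AddCommGroup Q] [Module ℤ[G] Q]

theorem ratAction_tmul (g : G) (q : ℚ) (x : P) :
    ratAction (G := G) P g (q ⊗ₜ[ℤ] x) = q ⊗ₜ[ℤ] (MonoidAlgebra.single g (1 : ℤ) • x) := by
  rfl

/-- An equivariant additive map from a `ℤ[G]`-module to a rational representation extends to the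
rationalization. -/
def ratRepLift (A : Rep.{0} ℚ G) (f : P →ₗ[ℤ] A)
    (hf : ∀ g x, f (MonoidAlgebra.single g (1 : ℤ) • x) = A.ρ g (f x)) :
    ratRep (G := G) P ⟶ A :=
  Rep.ofHom (ρ := ratAction (G := G) P) (σ := A.ρ) ⟨f.liftBaseChange ℚ, fun g => by
    refine TensorProduct.AlgebraTensorModule.ext fun q x => ?_
    change f.liftBaseChange ℚ (ratAction P g (q ⊗ₜ[ℤ] x)) =
      A.ρ g (f.liftBaseChange ℚ (q ⊗ₜ[ℤ] x))
    rw [ratAction_tmul, LinearMap.liftBaseChange_tmul, LinearMap.liftBaseChange_tmul, hf, map_smul]⟩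

/-- The map of rationalizations induced by a `ℤ[G]`-linear map. -/
def ratRepMap (f : P →ₗ[ℤ[G]] Q) : ratRep (G := G) P ⟶ ratRep (G := G) Q :=
  Rep.ofHom (ρ := ratAction (G := G) P) (σ := ratAction (G := G) Q)
    ⟨(f.restrictScalars ℤ).baseChange ℚ, fun g => by
      refine TensorProduct.AlgebraTensorModule.ext fun q x => ?_
      change (f.restrictScalars ℤ).baseChange ℚ (ratAction P g (q ⊗ₜ[ℤ] x)) =
        ratAction Q g ((f.restrictScalars ℤ).baseChange ℚ (q ⊗ₜ[ℤ] x))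
      rw [ratAction_tmul, LinearMap.baseChange_tmul, LinearMap.baseChange_tmul, ratAction_tmul]
      simp⟩

theorem ratRep_hom_ext {A : Rep.{0} ℚ G} {f g : ratRep (G := G) P ⟶ A}
    (h : ∀ x : P, f.hom ((1 : ℚ) ⊗ₜ[ℤ] x) = g.hom ((1 : ℚ) ⊗ₜ[ℤ] x)) : f = g := by
  refine Rep.hom_ext (Representation.IntertwiningMap.toLinearMap_injective _ _ ?_)
  refine TensorProduct.AlgebraTensorModule.ext fun q x => ?_
  have : q ⊗ₜ[ℤ] x = q • ((1 : ℚ) ⊗ₜ[ℤ] x) := by simp [TensorProduct.smul_tmul']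
  rw [this]
  exact ((f.hom.toLinearMap.map_smul q _).trans (congrArg (q • ·) (h x))).trans
    (g.hom.toLinearMap.map_smul q _).symm

/-- The `ℤ[G]`-module underlying a rational representation. -/
abbrev intRep (A : Rep.{0} ℚ G) : Representation ℤ G A :=
  { toFun := fun g => (A.ρ g).restrictScalars ℤ
    map_one' := by ext; simp
    map_mul' := fun g h => by ext; simp }

theorem intRep_smul (A : Rep.{0} ℚ G) (g : G) (x : A) :
    (intRep A).asModuleEquiv (MonoidAlgebra.single g (1 : ℤ) • (intRep A).asModuleEquiv.symm x) =
      A.ρ g x := by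
  simp only [Representation.single_smul, one_smul]
  rfl

/-- Restriction of a morphism out of the rationalization. -/
def ratRepRestrict {A : Rep.{0} ℚ G} (f : ratRep (G := G) P ⟶ A) :
    P →ₗ[ℤ[G]] (intRep A).asModule :=
  MonoidAlgebra.equivariantOfLinearOfComm
    ((intRep A).asModuleEquiv.symm.toLinearMap ∘ₗ
      (f.hom.toLinearMap.restrictScalars ℤ) ∘ₗ TensorProduct.mk ℤ ℚ P 1) fun g x => by
    apply (intRep A).asModuleEquiv.injective
    simp only [LinearMap.comp_apply, LinearEquiv.coe_coe]
    rw [intRep_smul]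
    exact Rep.hom_comm_apply f g ((1 : ℚ) ⊗ₜ[ℤ] x)

theorem ratRepRestrict_apply {A : Rep.{0} ℚ G} (f : ratRep (G := G) P ⟶ A) (x : P) :
    (intRep A).asModuleEquiv (ratRepRestrict f x) = f.hom ((1 : ℚ) ⊗ₜ[ℤ] x) := rfl

/-- The `ℤ[G]`-linear map underlying a morphism of rational representations. -/
def intRepMap {A B : Rep.{0} ℚ G} (f : A ⟶ B) :
    (intRep A).asModule →ₗ[ℤ[G]] (intRep B).asModule :=
  MonoidAlgebra.equivariantOfLinearOfComm
    ((intRep B).asModuleEquiv.symm.toLinearMap ∘ₗ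
      (f.hom.toLinearMap.restrictScalars ℤ) ∘ₗ (intRep A).asModuleEquiv.toLinearMap) fun g x => by
    obtain ⟨x, rfl⟩ := (intRep A).asModuleEquiv.symm.surjective x
    apply (intRep B).asModuleEquiv.injective
    simp only [LinearMap.comp_apply, LinearEquiv.coe_coe]
    rw [intRep_smul, intRep_smul]
    exact Rep.hom_comm_apply f g x

/-- Morphisms from `ℚ ⊗ P` to a rational representation are `ℤ[G]`-linear maps out of `P`, so lifts
are inherited from projectivity of `P`. -/
instance ratRep_projective [Module.Projective ℤ[G] P] : Projective (ratRep (G := G) P) where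
  factors {E X} f e _ := by
    have he : Function.Surjective (intRepMap e) := (Rep.epi_iff_surjective e).1 inferInstance
    obtain ⟨h, hh⟩ := Module.projective_lifting_property (intRepMap e) (ratRepRestrict f) he
    refine ⟨ratRepLift E ((intRep E).asModuleEquiv.toLinearMap ∘ₗ
      h.toAddMonoidHom.toIntLinearMap) fun g x => ?_, ratRep_hom_ext fun x => ?_⟩
    · change (intRep E).asModuleEquiv (h (_ • x)) = _
      rw [map_smul]
      exact intRep_smul E g _
    · rw [← ratRepRestrict_apply f, ← hh]
      change e.hom ((LinearMap.liftBaseChange ℚ _) ((1 : ℚ) ⊗ₜ[ℤ] x)) = _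
      rw [LinearMap.liftBaseChange_tmul, one_smul]
      rfl

/-- A morphism is determined by its values on finitely many generators of `P`. -/
theorem ratRep_hom_finite [Module.Finite ℤ[G] P] (A : Rep.{0} ℚ G) [FiniteDimensional ℚ A] :
    FiniteDimensional ℚ (ratRep (G := G) P ⟶ A) := by
  obtain ⟨s, hs⟩ := Module.Finite.fg_top (R := ℤ[G]) (M := P)
  let ev : (ratRep (G := G) P ⟶ A) →ₗ[ℚ] (s → A) :=
    { toFun := fun f x => f.hom ((1 : ℚ) ⊗ₜ[ℤ] (x : P))
      map_add' := fun f g => rfl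
      map_smul' := fun q f => rfl }
  refine FiniteDimensional.of_injective ev fun f g hfg => ratRep_hom_ext fun x => ?_
  have : ratRepRestrict f = ratRepRestrict g := by
    refine LinearMap.ext_on (s := (s : Set P)) hs fun y hy => ?_
    exact congrFun hfg ⟨y, hy⟩
  exact DFunLike.congr_fun this x

end Rationalization

/-! ### Finite-dimensionality of group cohomology. -/

section Resolution

variable {G : Type} [Group G]

theorem Rep_shortComplex_exact {A B C : Rep.{0} ℚ G} (f : A ⟶ B) (g : B ⟶ C) (w : f ≫ g = 0)
    (h : Function.Exact f.hom g.hom) : (ShortComplex.mk f g w).Exact := by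
  apply (forget₂ _ (ModuleCat ℚ)).reflects_exact_of_faithful
  rw [ShortComplex.moduleCat_exact_iff]
  intro x hx
  exact (h x).1 hx

theorem ratRepMap_exact {P Q R : Type} [AddCommGroup P] [Module ℤ[G] P] [AddCommGroup Q]
    [Module ℤ[G] Q] [AddCommGroup R] [Module ℤ[G] R] {f : P →ₗ[ℤ[G]] Q} {g : Q →ₗ[ℤ[G]] R}
    (h : Function.Exact f g) : Function.Exact (ratRepMap f).hom (ratRepMap g).hom :=
  Module.Flat.lTensor_exact ℚ (f := f.restrictScalars ℤ) (g := g.restrictScalars ℤ) h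

theorem ratRepMap_comp {P Q R : Type} [AddCommGroup P] [Module ℤ[G] P] [AddCommGroup Q]
    [Module ℤ[G] Q] [AddCommGroup R] [Module ℤ[G] R] {f : P →ₗ[ℤ[G]] Q} {g : Q →ₗ[ℤ[G]] R}
    (h : Function.Exact f g) : ratRepMap f ≫ ratRepMap g = 0 :=
  Rep.hom_ext (Representation.IntertwiningMap.toLinearMap_injective _ _
    (LinearMap.ext (ratRepMap_exact h).apply_apply_eq_zero))

/-- The additive map underlying an augmentation. -/
def augmentationInt {P : Type} [AddCommGroup P] [Module ℤ[G] P]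
    (ε : P →ₗ[ℤ[G]] (Representation.trivial ℤ G ℤ).asModule) : P →ₗ[ℤ] ℤ :=
  ((Representation.trivial ℤ G ℤ).asModuleEquiv.toAddMonoidHom.comp
    ε.toAddMonoidHom).toIntLinearMap

/-- The rationalized augmentation. -/
def ratAugmentation {P : Type} [AddCommGroup P] [Module ℤ[G] P]
    (ε : P →ₗ[ℤ[G]] (Representation.trivial ℤ G ℤ).asModule) :
    ratRep (G := G) P ⟶ Rep.trivial ℚ G ℚ :=
  ratRepLift _ ((Int.castAddHom ℚ).comp (augmentationInt ε).toAddMonoidHom).toIntLinearMap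
    fun g x => by
      change ((Representation.asModuleEquiv _ (ε (_ • x)) : ℤ) : ℚ) =
        ((Representation.asModuleEquiv _ (ε x) : ℤ) : ℚ)
      rw [map_smul, Representation.single_smul]
      simp
      rfl

theorem ratAugmentation_tmul {P : Type} [AddCommGroup P] [Module ℤ[G] P]
    (ε : P →ₗ[ℤ[G]] (Representation.trivial ℤ G ℤ).asModule) (q : ℚ) (x : P) :
    (ratAugmentation ε).hom (q ⊗ₜ[ℤ] x) =
      q * (((Representation.trivial ℤ G ℤ).asModuleEquiv (ε x) : ℤ) : ℚ) := rfl

/-- The underlying additive map of the rationalized augmentation factors through `ℚ ⊗ ε`. -/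
theorem ratAugmentation_eq {P : Type} [AddCommGroup P] [Module ℤ[G] P]
    (ε : P →ₗ[ℤ[G]] (Representation.trivial ℤ G ℤ).asModule) (y : ℚ ⊗[ℤ] P) :
    (ratAugmentation ε).hom y =
      TensorProduct.rid ℤ ℚ (LinearMap.lTensor ℚ (augmentationInt ε) y) := by
  induction y with
  | zero => simp
  | add x y hx hy => rw [map_add, map_add, map_add, hx, hy]
  | tmul q x =>
    rw [ratAugmentation_tmul, LinearMap.lTensor_tmul, TensorProduct.rid_tmul, zsmul_eq_mul,
      mul_comm]
    rfl

theorem ratAugmentation_exact {P Q : Type} [AddCommGroup P] [Module ℤ[G] P] [AddCommGroup Q]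
    [Module ℤ[G] Q] {f : Q →ₗ[ℤ[G]] P}
    {ε : P →ₗ[ℤ[G]] (Representation.trivial ℤ G ℤ).asModule}
    (h : Function.Exact f ε) : Function.Exact (ratRepMap f).hom (ratAugmentation ε).hom := by
  intro y
  have h' := Module.Flat.lTensor_exact ℚ (f := f.restrictScalars ℤ)
    (g := (augmentationInt ε)) (fun x => h x)
  refine Iff.trans ?_ (h' y)
  rw [ratAugmentation_eq]
  exact (TensorProduct.rid ℤ ℚ).map_eq_zero_iff

theorem ratAugmentation_surjective {P : Type} [AddCommGroup P] [Module ℤ[G] P]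
    {ε : P →ₗ[ℤ[G]] (Representation.trivial ℤ G ℤ).asModule} (h : Function.Surjective ε) :
    Function.Surjective (ratAugmentation ε).hom := by
  intro q
  obtain ⟨x, hx⟩ := h ((Representation.trivial ℤ G ℤ).asModuleEquiv.symm (1 : ℤ))
  refine ⟨q ⊗ₜ[ℤ] x, ?_⟩
  rw [ratAugmentation_tmul, hx]
  simp

/-- Tensoring with the flat `ℤ`-module `ℚ` keeps the given resolution exact, and turns its
augmentation onto `ℤ` into one onto `ℚ`. -/
theorem exists_finite_projectiveResolution (hG : TypeFPInfinity G) :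
    ∃ R : ProjectiveResolution (Rep.trivial ℚ G ℚ : Rep.{0} ℚ G),
      ∀ (n : ℕ) (A : Rep.{0} ℚ G), FiniteDimensional ℚ A →
        FiniteDimensional ℚ (R.complex.X n ⟶ A) := by
  obtain ⟨P, _, _, d, ε, hfin, hproj, hε, hd0, hd⟩ := hG
  let K : ChainComplex (Rep.{0} ℚ G) ℕ := ChainComplex.of (fun n => ratRep (G := G) (P n))
    (fun n => ratRepMap (d n)) fun n => ratRepMap_comp (hd n)
  have hKd : ∀ n, K.d (n + 1) n = ratRepMap (d n) := fun n => by simp [K]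
  have w : ratRepMap (d 0) ≫ ratAugmentation ε = 0 :=
    Rep.hom_ext (Representation.IntertwiningMap.toLinearMap_injective _ _
      (LinearMap.ext (ratAugmentation_exact hd0).apply_apply_eq_zero))
  have : Epi (ratAugmentation ε) :=
    (Rep.epi_iff_surjective _).2 (ratAugmentation_surjective hε)
  refine ⟨{ complex := K
            projective := fun n => inferInstanceAs (Projective (ratRep (G := G) (P n)))
            π := (ChainComplex.toSingle₀Equiv _ _).symm ⟨ratAugmentation ε, by rw [hKd]; exact w⟩
            quasiIso := ⟨fun n => ?_⟩ }, fun n A _ => ratRep_hom_finite (P := P n) A⟩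
  cases n with
  | zero =>
    rw [ChainComplex.quasiIsoAt₀_iff, ShortComplex.quasiIso_iff_of_zeros']
    · refine (ShortComplex.exact_and_epi_g_iff_of_iso ?_).2
        ⟨Rep_shortComplex_exact _ _ w (ratAugmentation_exact hd0), this⟩
      exact ShortComplex.isoMk (Iso.refl _) (Iso.refl _) (Iso.refl _)
        (by simp [hKd]; exact (Category.id_comp _).trans (Category.comp_id _).symm)
        (by simp; exact (Category.id_comp _).trans (Category.comp_id _).symm)
    all_goals rfl
  | succ n =>
    rw [quasiIsoAt_iff_exactAt']
    · rw [HomologicalComplex.exactAt_iff' _ (n + 2) (n + 1) n (by simp) (by simp)]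
      refine (ShortComplex.exact_iff_of_iso ?_).2
        (Rep_shortComplex_exact _ _ (ratRepMap_comp (hd n)) (ratRepMap_exact (hd n)))
      exact ShortComplex.isoMk (Iso.refl _) (Iso.refl _) (Iso.refl _)
        (by simp [hKd]; exact (Category.id_comp _).trans (Category.comp_id _).symm)
        (by simp [hKd]; exact (Category.id_comp _).trans (Category.comp_id _).symm)
    · apply ChainComplex.exactAt_succ_single_obj

/-- Cohomology is a subquotient of the finite-dimensional space of morphisms from the `p`-th term of
the resolution. -/
theorem groupCohomology_finiteDimensional (hG : TypeFPInfinity G) (A : Rep.{0} ℚ G)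
    [FiniteDimensional ℚ A] (p : ℕ) : FiniteDimensional ℚ (groupCohomology A p) := by
  obtain ⟨R, hR⟩ := exists_finite_projectiveResolution hG
  let L := R.complex.linearYonedaObj ℚ A
  have : FiniteDimensional ℚ (L.X p) := hR p A inferInstance
  have : FiniteDimensional ℚ (L.cycles p) :=
    FiniteDimensional.of_injective (L.iCycles p).hom
      ((ModuleCat.mono_iff_injective _).1 inferInstance)
  have : FiniteDimensional ℚ (L.homology p) :=
    Module.Finite.of_surjective (L.homologyπ p).hom
      ((ModuleCat.epi_iff_surjective _).1 inferInstance)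
  exact Module.Finite.equiv (groupCohomologyIso A p R).toLinearEquiv.symm

end Resolution

/-! ### Transfer of stability to cohomology. -/

namespace CompatibleSeq

open Finset MonoidAlgebra CategoryTheory

variable {G : Type} [Group G] (X : CompatibleSeq G) {n : ℕ}

/-- An element of `ℚ[S_n]`, acting on `V n` by an endomorphism of `G`-representations. -/
def actHom (n : ℕ) (x : QS n) : X.rep n ⟶ X.rep n :=
  Rep.ofHom ⟨(X.ρ n).asAlgebraHom x, fun g => by
    rw [eq_sum_smul_single x]
    refine LinearMap.ext fun v => ?_
    simp [Representation.asAlgebraHom_single, X.comm]⟩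

theorem Rep_hom_ext' {A B : Rep.{0} ℚ G} {f g : A ⟶ B} (h : ∀ v, f.hom v = g.hom v) : f = g :=
  Rep.hom_ext (Representation.IntertwiningMap.toLinearMap_injective _ _ (LinearMap.ext h))

theorem actHom_eq_sum (x : QS n) : X.actHom n x = ∑ g, x.coeff g • X.permHom n g := by
  refine Rep_hom_ext' fun v => ?_
  change (X.ρ n).asAlgebraHom x v = _
  conv_lhs => rw [eq_sum_smul_single x]
  have : ∀ s : Finset (Equiv.Perm (Fin n)), (∑ g ∈ s, x.coeff g • X.permHom n g).hom v =
      ∑ g ∈ s, x.coeff g • X.ρ n g v := fun s => by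
    induction s using Finset.cons_induction with
    | empty => rfl
    | cons a s ha ih =>
      rw [sum_cons, sum_cons, ← ih]
      rfl
  rw [this]
  simp [Representation.asAlgebraHom_single, LinearMap.sum_apply]

instance (p : ℕ) : (groupCohomology.functor ℚ G p).Additive :=
  inferInstanceAs (groupCohomology.cochainsFunctor ℚ G ⋙
    HomologicalComplex.homologyFunctor _ _ p).Additive

/-- The map induced in cohomology by a morphism of coefficients. -/
def cohMap (p : ℕ) {m n : ℕ} (f : X.rep m ⟶ X.rep n) :
    (X.cohomology p).mod m →ₗ[ℚ] (X.cohomology p).mod n :=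
  ((X.cohomology p).ρ n).asModuleEquiv.symm.toLinearMap ∘ₗ
    ((groupCohomology.functor ℚ G p).map f).hom ∘ₗ
      ((X.cohomology p).ρ m).asModuleEquiv.toLinearMap

theorem cohMap_comp (p : ℕ) {l m n : ℕ} (f : X.rep l ⟶ X.rep m) (g : X.rep m ⟶ X.rep n) :
    X.cohMap p (f ≫ g) = X.cohMap p g ∘ₗ X.cohMap p f := by
  rw [cohMap, Functor.map_comp]
  rfl

theorem cohMap_smul (p : ℕ) {m n : ℕ} (q : ℚ) (f : X.rep m ⟶ X.rep n) :
    X.cohMap p (q • f) = q • X.cohMap p f := by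
  rw [cohMap, Functor.map_smul]
  rfl

theorem cohMap_zero (p : ℕ) {m n : ℕ} : X.cohMap p (0 : X.rep m ⟶ X.rep n) = 0 := by
  rw [cohMap, Functor.map_zero]
  rfl

theorem cohMap_add (p : ℕ) {m n : ℕ} (f g : X.rep m ⟶ X.rep n) :
    X.cohMap p (f + g) = X.cohMap p f + X.cohMap p g := by
  rw [cohMap, Functor.map_add]
  rfl

theorem cohMap_sum (p : ℕ) {m n : ℕ} {ι : Type} (s : Finset ι) (f : ι → (X.rep m ⟶ X.rep n)) :
    X.cohMap p (∑ i ∈ s, f i) = ∑ i ∈ s, X.cohMap p (f i) :=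
  map_sum (AddMonoidHom.mk' (X.cohMap p) (X.cohMap_add p)) f s

/-- Linearity of `H^p` in morphisms extends the induced action from permutations to the whole group
algebra, so Young symmetrizers on cohomology are induced from those on coefficients. -/
theorem cohMap_actHom (p : ℕ) (x : QS n) (v : (X.cohomology p).mod n) :
    X.cohMap p (X.actHom n x) v = x • v := by
  conv_rhs => rw [eq_sum_smul_single x]
  rw [actHom_eq_sum, cohMap_sum, LinearMap.sum_apply, sum_smul]
  refine sum_congr rfl fun g _ => ?_
  rw [cohMap_smul, smul_assoc, Representation.single_smul, one_smul]
  rfl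

theorem cohMap_φHom (p : ℕ) : X.cohMap p (X.φHom n) = (X.cohomology p).φLin n := rfl

/-- The identification of multiplicity spaces is inverted by a map of `G`-representations. -/
theorem exists_inverse (hX : X.toConsistentSeq.YoungStable n) (μ : YoungDiagram)
    (h : μ.card + μ.rowLen 0 ≤ n) (h' : μ.card + μ.rowLen 0 ≤ n + 1)
    (T : Fin n ≃ (padded μ n h).cells) (U : Fin (n + 1) ≃ (padded μ (n + 1) h').cells)
    (hTU : ExtendsTableau T U) :
    ∃ ψ : X.rep (n + 1) ⟶ X.rep n,
      ψ ≫ X.φHom n ≫ X.actHom (n + 1) (youngSymmetrizer U) =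
        X.actHom (n + 1) (youngSymmetrizer U) ∧
      (∃ s : ℚ, s ≠ 0 ∧ X.actHom n (youngSymmetrizer T) ≫ X.φHom n ≫
        X.actHom (n + 1) (youngSymmetrizer U) ≫ ψ = s • X.actHom n (youngSymmetrizer T)) ∧
      ∃ t : ℚ, t ≠ 0 ∧ ψ ≫ X.actHom n (youngSymmetrizer T) = t • ψ := by
  obtain ⟨s, hs, hss⟩ := exists_smul_eq_of_mem_youngRange (M := X.mod (n + 1)) U
  obtain ⟨t, ht, htt⟩ := exists_smul_eq_of_mem_youngRange (M := X.mod n) T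
  let f : youngRange T (X.mod n) →ₗ[ℚ] youngRange U (X.mod (n + 1)) :=
    LinearMap.codRestrict _
      ((Algebra.lsmul ℚ ℚ _ (youngSymmetrizer U) ∘ₗ X.φLin n) ∘ₗ Submodule.subtype _)
      fun v => smul_mem_youngRange U _
  have hf : Function.Bijective f := ⟨(injective_iff_map_eq_zero f).2 fun v hv =>
      Subtype.ext (hX.eq_zero μ h h' T U hTU v v.2 (congrArg Subtype.val hv)), fun w => by
    obtain ⟨v, hv, hvw⟩ := hX.exists_eq μ h h' T U hTU w w.2
    exact ⟨⟨v, hv⟩, Subtype.ext hvw⟩⟩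
  let e := LinearEquiv.ofBijective f hf
  -- Apply `c_U`, then invert the identification with `c_T V_n`. Precomposing with `c_U` makes the
  -- map defined on all of `V (n + 1)`.
  let ψ : X.mod (n + 1) →ₗ[ℚ] X.mod n := Submodule.subtype _ ∘ₗ e.symm.toLinearMap ∘ₗ
    LinearMap.codRestrict (youngRange U (X.mod (n + 1)))
      (Algebra.lsmul ℚ ℚ _ (youngSymmetrizer U)) fun w => smul_mem_youngRange U w
  have hψmem : ∀ w, ψ w ∈ youngRange T (X.mod n) := fun w => (e.symm _).2
  have hψ : ∀ w, youngSymmetrizer U • X.φLin n (ψ w) = youngSymmetrizer U • w := fun w =>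
    congrArg Subtype.val (e.apply_symm_apply ⟨youngSymmetrizer U • w, smul_mem_youngRange U w⟩)
  -- This characterization of `ψ w` yields `G`-equivariance: `g ψ(w)` satisfies the condition
  -- defining `ψ(g w)`.
  have huniq : ∀ v ∈ youngRange T (X.mod n), ∀ w,
      youngSymmetrizer U • X.φLin n v = youngSymmetrizer U • w → ψ w = v := fun v hv w hvw => by
    rw [← sub_eq_zero]
    refine hX.eq_zero μ h h' T U hTU _ (Submodule.sub_mem _ (hψmem w) hv) ?_
    rw [map_sub, smul_sub, hψ, hvw, sub_self]
  have hcomm : ∀ (m : ℕ) (x : QS m) (g : G) (v : X.mod m),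
      X.τ m g (x • v : X.mod m) = (x • (show X.mod m from X.τ m g v) : X.mod m) := fun m x g v =>
    (Rep.hom_comm_apply (X.actHom m x) g v).symm
  have hG : ∀ (g : G) (w : X.mod (n + 1)), ψ (X.τ (n + 1) g w) = X.τ n g (ψ w) := fun g w => by
    refine huniq _ ?_ _ ?_
    · obtain ⟨u, hu⟩ := hψmem w
      rw [← hu]
      exact ⟨X.τ n g u, (hcomm n _ g u).symm⟩
    · have h1 : X.φLin n (X.τ n g (ψ w)) = X.τ (n + 1) g (X.φLin n (ψ w)) := X.φ_comm n g (ψ w)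
      rw [h1]
      exact (hcomm _ _ g _).symm.trans ((congrArg (X.τ (n + 1) g) (hψ w)).trans (hcomm _ _ g w))
  have hB : ∀ v : X.mod n, ψ (youngSymmetrizer U • X.φLin n (youngSymmetrizer T • v)) =
      s • youngSymmetrizer T • v := fun v => by
    refine huniq _ (Submodule.smul_mem _ s (smul_mem_youngRange T v)) _ ?_
    rw [map_smul, hss _ (smul_mem_youngRange U _), smul_comm]
  exact ⟨Rep.ofHom (ρ := X.τ (n + 1)) (σ := X.τ n) ⟨ψ, fun g => LinearMap.ext (hG g)⟩,
    Rep_hom_ext' fun v => hψ v, ⟨s, hs, Rep_hom_ext' fun v => hB v⟩,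
    t, ht, Rep_hom_ext' fun w => htt _ (hψmem w)⟩

/-- Applying `H^p` to the identities for `ψ` gives injectivity and surjectivity on multiplicity
spaces, and a symmetrizer that is zero on coefficients is zero on cohomology. No exactness of `H^p`
is needed. -/
theorem cohomology_youngStable (hX : X.toConsistentSeq.YoungStable n) (p : ℕ) :
    (X.cohomology p).YoungStable n := by
  refine ⟨fun μ h h' T U hTU v hv hv0 => ?_, fun μ h h' T U hTU w hw => ?_,
    fun μ h h' U w => ?_⟩
  · obtain ⟨ψ, -, ⟨s, hs, hψ⟩, -⟩ := X.exists_inverse hX μ h h' T U hTU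
    obtain ⟨u, rfl⟩ := (mem_youngRange T).1 hv
    have h1 := congrArg (fun f => X.cohMap p f u) hψ
    simp only [cohMap_comp, cohMap_smul, LinearMap.comp_apply, LinearMap.smul_apply, cohMap_actHom,
      cohMap_φHom, hv0, map_zero] at h1
    exact (smul_eq_zero.1 h1.symm).resolve_left hs
  · obtain ⟨ψ, hψ, -, t, ht, htt⟩ := X.exists_inverse hX μ h h' T U hTU
    obtain ⟨u, rfl⟩ := (mem_youngRange U).1 hw
    have h1 := congrArg (fun f => X.cohMap p f u) hψ
    have h2 := congrArg (fun f => X.cohMap p f u) htt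
    simp only [cohMap_comp, cohMap_smul, LinearMap.comp_apply, LinearMap.smul_apply, cohMap_actHom,
      cohMap_φHom] at h1 h2
    refine ⟨X.cohMap p ψ u, ?_, h1⟩
    rw [← inv_smul_smul₀ ht (X.cohMap p ψ u), ← h2]
    exact Submodule.smul_mem _ _ (smul_mem_youngRange T _)
  · have h1 : X.actHom (n + 1) (youngSymmetrizer U) = 0 :=
      Rep_hom_ext' fun v => hX.smul_eq_zero μ h h' U v
    rw [← cohMap_actHom, h1, cohMap_zero, LinearMap.zero_apply]

end CompatibleSeq
end RepStab

end

theorem mainTheorem3 (G : Type) [Group G] (hG : RepStab.TypeFPInfinity G)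
    (X : RepStab.CompatibleSeq G) (N : ℕ)
    (hmono : X.toConsistentSeq.Monotone N)
    (hstab : X.toConsistentSeq.UniformlyRepStable N) (p : ℕ) :
    (X.cohomology p).Monotone N ∧ (X.cohomology p).UniformlyRepStable N := by
  have h : ∀ n, 1 ≤ n → N ≤ n → (X.cohomology p).YoungStable n := fun n h1 hN =>
    X.cohomology_youngStable (X.toConsistentSeq.youngStable_of_monotone hmono hstab h1 hN) p
  refine ⟨RepStab.ConsistentSeq.monotone_of_youngStable _ h,
    RepStab.ConsistentSeq.uniformlyRepStable_of_youngStable _ (fun n h1 => ?_) h⟩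
  have := hstab.finiteDimensional n h1
  exact RepStab.groupCohomology_finiteDimensional hG (X.rep n) p
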